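/- **Setting.** Let $K$ be the number of arms, $[K]=\{1,\dots,K\}$, and let $\nu=(\nu_1,\dots,\nu_K)$ be probability distributions supported on $[0,1]$, with means $\mu=(\mu_1,\dots,\mu_K)$. Let $\mathcal P$ be a set of probability vectors over $[K]$ (mixed actions) that is the convex hull of a finite set $\mathrm{Ext}(\mathcal P)$ (for instance the set of its extreme points). In each round $t=1,2,\dots$ the learner picks, based on past information (and possibly external randomization), a mixed action $p_t\in\mathcal P$; then an arm $A_t$ is drawn according to $p_t$ and a reward $Y_t$ is drawn according to $\nu_{A_t}$ and observed. The regret is $$R_T(\nu)=T\max_{p\in\mathcal P}\langle p,\mu\rangle-\mathbb E\Bigl[\sum_{t=1}^T\langle p_t,\mu\rangle\Bigr].$$ **Algorithm (diversity-preserving UCB).** Let $N_a(t)=\sum_{s=1}^t\mathbf 1\{A_s=a\}$, let $\widehat\mu_a(t)$ be the average of the rewards obtained from arm $a$ in rounds $1,\dots,t$ if $N_a(t)\ge1$, and $\widehat\mu_a(t)=1$ if $N_a(t)=0$. Put $U_a(0)=1$ and, for $t\ge1$, $U_a(t)=\widehat\mu_a(t)+\sqrt{2\ln t/\max\{N_a(t),1\}}$.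 In round $t$ the algorithm plays some $p_t\in\operatorname{argmax}_{p\in\mathrm{Ext}(\mathcal P)}\langle p,U(t-1)\rangle$, ties being broken arbitrarily. **Notation.** $\mathrm{Opt}(\nu)=\operatorname{argmax}_{p\in\mathcal P}\langle p,\mu\rangle$; $\Delta(p)=\max_{q\in\mathcal P}\langle q,\mu\rangle-\langle p,\mu\rangle$; $\Delta=\min\{\Delta(p):p\in\mathrm{Ext}(\mathcal P),\ \Delta(p)>0\}$, where it is assumed that some $p\in\mathrm{Ext}(\mathcal P)$ has $\Delta(p)>0$; $p^\star_{\min}(\nu)=\min_{p\in\mathrm{Opt}(\nu)}\min_{a\in[K]}p_a$; $\ell=\min_{p\in\mathcal P}\min_{a\in[K]}p_a$. **Theorem.** The regret of diversity-preserving UCB satisfies the following, for all such $\mathcal P$ and $\nu$. 1. In all cases, for all $T$, $$R_T(\nu)\le\frac{24K(\ln(1+T))^2+K+2}{\Delta}.$$ 2. If $p^\star_{\min}(\nu)>0$, then the regret is bounded: $\lim_{T\to\infty}R_T(\nu)$ exists and is finite, and it is at most a constant that depends only on $\mathcal P$, $\mathrm{Ext}(\mathcal P)$ and $\nu$ (not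 on the tie-breaking rule). 3. If $\ell>0$, then for all $T$, $$R_T(\nu)\le\frac{24K}{\Delta}\ln\Bigl(1+\frac{32}{\Delta^2\ell}\ln\Bigl(\frac{16}{\Delta^2\ell}\Bigr)\Bigr)+\frac{7K+3}{\min\{\Delta,\ell^2\}}.$$ -/

import Mathlib

open MeasureTheory ProbabilityTheory Filter Topology

universe u

noncomputable section

namespace DivBandit

/-! ### Gaps and minimal probabilities

`K` arms, indexed by `Fin K`; a bandit problem is a family `ν : Fin K → Measure ℝ` of reward
distributions.  A mixed action is a vector `p : Fin K → ℝ` in the probability simplex. -/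

/-- The vector of means of the arms. -/
def means {K : ℕ} (ν : Fin K → Measure ℝ) (a : Fin K) : ℝ := ∫ y, y ∂(ν a)

/-- The expected payoff `⟨p, μ⟩` of a mixed action `p` when the means are `μ`. -/
def payoff {K : ℕ} (p μ : Fin K → ℝ) : ℝ := ∑ a, p a * μ a

/-- The optimal expected payoff `max_{p ∈ P} ⟨p, μ⟩`. -/
def optPayoff {K : ℕ} (P : Set (Fin K → ℝ)) (μ : Fin K → ℝ) : ℝ :=
  sSup ((fun p => payoff p μ) '' P)

/-- The set of optimal mixed actions `argmax_{p ∈ P} ⟨p, μ⟩`. -/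
def optActions {K : ℕ} (P : Set (Fin K → ℝ)) (μ : Fin K → ℝ) : Set (Fin K → ℝ) :=
  {p | p ∈ P ∧ ∀ q ∈ P, payoff q μ ≤ payoff p μ}

/-- The suboptimality gap `Δ(p)` of a mixed action. -/
def gap {K : ℕ} (P : Set (Fin K → ℝ)) (μ p : Fin K → ℝ) : ℝ :=
  optPayoff P μ - payoff p μ

/-- The gap `Δ = min {Δ(p) : p ∈ E, Δ(p) > 0}` of a finite set `E` of mixed actions. -/
def minGap {K : ℕ} (P : Set (Fin K → ℝ)) (E : Finset (Fin K → ℝ)) (μ : Fin K → ℝ) : ℝ :=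
  sInf {x | ∃ p ∈ E, 0 < gap P μ p ∧ x = gap P μ p}

/-- The least probability `min_{p ∈ S} min_a p_a` given to an arm by a mixed action of `S`. -/
def minProb {K : ℕ} (S : Set (Fin K → ℝ)) : ℝ :=
  sInf {x | ∃ p ∈ S, ∃ a, x = p a}

/-! ### The indices of the algorithm

`A t ω` and `Y t ω` are the arm and the reward of round `t = 1, 2, …`; the values at `t = 0` are
never used. -/

/-- `N_a(t)`: the number of times arm `a` was drawn in rounds `1, …, t`. -/
def pulls {Ω : Type*} {K : ℕ} (A : ℕ → Ω → Fin K) (a : Fin K) (t : ℕ) (ω : Ω) : ℕ :=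
  ((Finset.Icc 1 t).filter (fun s => A s ω = a)).card

/-- The empirical mean of arm `a` after `t` rounds, equal to `1` if the arm was never drawn. -/
def empMean {Ω : Type*} {K : ℕ} (A : ℕ → Ω → Fin K) (Y : ℕ → Ω → ℝ)
    (a : Fin K) (t : ℕ) (ω : Ω) : ℝ :=
  if pulls A a t ω = 0 then 1
  else (∑ s ∈ (Finset.Icc 1 t).filter (fun s => A s ω = a), Y s ω) / (pulls A a t ω : ℝ)

/-- The upper confidence bound `U_a(t)`, initialized at `U_a(0) = 1`. -/
def ucb {Ω : Type*} {K : ℕ} (A : ℕ → Ω → Fin K) (Y : ℕ → Ω → ℝ)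
    (t : ℕ) (ω : Ω) (a : Fin K) : ℝ :=
  if t = 0 then 1
  else empMean A Y a t ω + Real.sqrt (2 * Real.log t / (max (pulls A a t ω) 1 : ℕ))

/-! ### The interaction protocol and the algorithm -/

/-- The diversity-preserving bandit protocol with set of mixed actions `P` and reward
distributions `ν`: in round `t + 1`, the learner picks `p (t + 1) ∈ P` from the information `ℱ t`
available after `t` rounds (past mixed actions, arms, rewards, and possibly external
randomization), then the arm is drawn according to `p (t + 1)` and the reward according to the
distribution of that arm. The law of the pair (arm, reward) given `ℱ t` is therefore
`B ↦ p (t + 1) a * ν a B` on the event that the arm is `a`. -/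
structure IsProtocol {Ω : Type*} {mΩ : MeasurableSpace Ω} {K : ℕ} (P : Set (Fin K → ℝ))
    (ν : Fin K → Measure ℝ) (Pr : Measure Ω) (ℱ : Filtration ℕ mΩ)
    (p : ℕ → Ω → Fin K → ℝ) (A : ℕ → Ω → Fin K) (Y : ℕ → Ω → ℝ) : Prop where
  mem : ∀ t ω, p (t + 1) ω ∈ P
  measurable_action : ∀ t, Measurable[ℱ t] (p (t + 1))
  measurable_arm : ∀ t, Measurable[ℱ (t + 1)] (A (t + 1))
  measurable_reward : ∀ t, Measurable[ℱ (t + 1)] (Y (t + 1))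
  cond_law : ∀ (t : ℕ) (a : Fin K) (B : Set ℝ), MeasurableSet B →
    Pr[Set.indicator (A (t + 1) ⁻¹' {a} ∩ Y (t + 1) ⁻¹' B) (fun _ => (1 : ℝ)) | ℱ t]
      =ᵐ[Pr] fun ω => p (t + 1) ω a * (ν a).real B

/-- A run of diversity-preserving UCB: in each round the mixed action maximizes the linear form
given by the current upper confidence bounds over the finite set `E` (ties broken arbitrarily). -/
structure IsDivUCB {Ω : Type*} {mΩ : MeasurableSpace Ω} {K : ℕ} (P : Set (Fin K → ℝ))
    (E : Finset (Fin K → ℝ)) (ν : Fin K → Measure ℝ) (Pr : Measure Ω) (ℱ : Filtration ℕ mΩ)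
    (p : ℕ → Ω → Fin K → ℝ) (A : ℕ → Ω → Fin K) (Y : ℕ → Ω → ℝ) : Prop
    extends IsProtocol P ν Pr ℱ p A Y where
  argmax_mem : ∀ t ω, p (t + 1) ω ∈ E
  argmax : ∀ t ω, ∀ q ∈ E, payoff q (ucb A Y t ω) ≤ payoff (p (t + 1) ω) (ucb A Y t ω)

/-- The expected regret `R_T = T max_{p ∈ P} ⟨p, μ⟩ - 𝔼 [∑_{t = 1}^T ⟨p_t, μ⟩]`. -/
def regret {Ω : Type*} {mΩ : MeasurableSpace Ω} {K : ℕ} (P : Set (Fin K → ℝ))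
    (ν : Fin K → Measure ℝ) (Pr : Measure Ω) (p : ℕ → Ω → Fin K → ℝ) (T : ℕ) : ℝ :=
  T * optPayoff P (means ν) - ∫ ω, ∑ t ∈ Finset.Icc 1 T, payoff (p t ω) (means ν) ∂Pr

end DivBandit

end

/-! Optimism drives everything. If no empirical mean leaves its confidence interval after `t`
rounds, then `⟨e, μ⟩ ≤ ⟨e, U⟩ ≤ ⟨p, U⟩` for an optimal `e` and the action `p` played, so the gap `G`
of `p` is at most the `p`-average of the excesses `U_a - μ_a`, hence of twice the bonuses
(`IsDivUCB.gap_le`). The exceptional events have summable probabilities and gaps are at most 1, so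
they cost a constant. Since `p` lies in the finite set `E`, either `G = 0` or `G ≥ Δ`. Finally,
`p_a` is the conditional probability of drawing `a`, so the expected sum of `f(N_a) p_a` over the
rounds equals that of `f(n)` over `n < N_a(T)` (`IsProtocol.regret_le`).

Universal bound: `G ≤ G² / Δ` and Jensen's inequality bound the gap by the `p`-average of `8 ln T /
(Δ N_a)`; the harmonic sum supplies the second logarithm.

All actions diverse: by Azuma–Hoeffding each arm has been drawn at least `ℓ t / 2` times. A
suboptimal action then needs `t ≤ (16 / (Δ² ℓ)) ln t`, which caps `ln t` by a constant `L`. Using `G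
≤ 2G - Δ`, the cost of an arm becomes a sum of positive parts of `C / √n - Δ`, at most `C² / Δ`.

Only optimal actions diverse: the argument is a bootstrap. The pathwise form of the universal bound
shows that suboptimal actions fill only `o(t)` of the rounds between `t / 4` and `t`. The other
rounds there play optimal actions, so every arm is drawn linearly often
(`IsDivUCB.countBound_le_pulls`). The bonuses are then too small for any further suboptimal play,
except with probability `O(t⁻²)`. The regret is thus bounded, and it converges because it is
nondecreasing. -/

namespace DivBandit

open scoped ENNReal NNReal

/-! ### Linear forms and gaps on the polytope of mixed actions. -/

section Geometry

variable {K : ℕ}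

lemma payoff_mono {p u v : Fin K → ℝ} (hp : ∀ a, 0 ≤ p a) (huv : ∀ a, u a ≤ v a) :
    payoff p u ≤ payoff p v :=
  Finset.sum_le_sum fun a _ => mul_le_mul_of_nonneg_left (huv a) (hp a)

lemma payoff_nonneg {p μ : Fin K → ℝ} (hp : ∀ a, 0 ≤ p a) (hμ : ∀ a, 0 ≤ μ a) :
    0 ≤ payoff p μ :=
  Finset.sum_nonneg fun a _ => mul_nonneg (hp a) (hμ a)

lemma payoff_le_one {p μ : Fin K → ℝ} (hp : p ∈ stdSimplex ℝ (Fin K)) (hμ : ∀ a, μ a ≤ 1) :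
    payoff p μ ≤ 1 := by
  calc payoff p μ ≤ payoff p (fun _ => 1) := payoff_mono hp.1 hμ
    _ = 1 := by simpa [payoff] using hp.2

lemma convex_payoff_le (μ : Fin K → ℝ) (c : ℝ) : Convex ℝ {p : Fin K → ℝ | payoff p μ ≤ c} := by
  refine convex_halfSpace_le (f := fun p => payoff p μ) ⟨fun x y => ?_, fun c x => ?_⟩ c
  · simp [payoff, add_mul, Finset.sum_add_distrib]
  · simp [payoff, Finset.mul_sum, mul_assoc]

/-- The rewards of the arms lie in `[0, 1]`, hence so do the means. -/
lemma means_mem_Icc {ν : Fin K → Measure ℝ} (hprob : ∀ a, IsProbabilityMeasure (ν a))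
    (hν : ∀ a, ν a (Set.Icc 0 1) = 1) (a : Fin K) : means ν a ∈ Set.Icc (0 : ℝ) 1 := by
  have h := hprob a
  have hae : ∀ᵐ y ∂(ν a), y ∈ Set.Icc (0 : ℝ) 1 :=
    (mem_ae_iff_prob_eq_one measurableSet_Icc).2 (hν a)
  exact Convex.integral_mem (convex_Icc 0 1) isClosed_Icc hae
    (Integrable.of_mem_Icc 0 1 aemeasurable_id hae)

/-- A linear form attains its maximum over the convex hull of a finite set on this finite set. -/
lemma exists_optimal_mem {P : Set (Fin K → ℝ)} {E : Finset (Fin K → ℝ)}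
    (hE : P = convexHull ℝ (E : Set (Fin K → ℝ))) (hne : E.Nonempty) (μ : Fin K → ℝ) :
    ∃ e ∈ E, optPayoff P μ = payoff e μ ∧ ∀ q ∈ P, payoff q μ ≤ payoff e μ := by
  obtain ⟨e, he, hmax⟩ := E.exists_max_image (fun p => payoff p μ) hne
  have hle : ∀ q ∈ P, payoff q μ ≤ payoff e μ := by
    intro q hq
    rw [hE] at hq
    exact convexHull_min (s := (E : Set (Fin K → ℝ))) (fun p hp => hmax p hp)
      (convex_payoff_le μ (payoff e μ)) hq
  have heP : e ∈ P := hE ▸ subset_convexHull ℝ _ he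
  refine ⟨e, he, ?_, hle⟩
  exact IsGreatest.csSup_eq ⟨⟨e, heP, rfl⟩, by rintro _ ⟨q, hq, rfl⟩; exact hle q hq⟩

lemma minProb_le {S : Set (Fin K → ℝ)} (hS : S ⊆ stdSimplex ℝ (Fin K)) {p : Fin K → ℝ}
    (hp : p ∈ S) (a : Fin K) : minProb S ≤ p a :=
  csInf_le ⟨0, by rintro _ ⟨q, hq, b, rfl⟩; exact (hS hq).1 b⟩ ⟨p, hp, a, rfl⟩

/-- The facts about a bandit problem used in the analysis: `e` is an optimal action of `E`, `μ` is
the vector of means, and `Δ` is a lower bound on the positive gaps. -/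
structure IsBanditModel (P : Set (Fin K → ℝ)) (E : Finset (Fin K → ℝ)) (ν : Fin K → Measure ℝ)
    (e : Fin K → ℝ) (Δ : ℝ) : Prop where
  simplex : P ⊆ stdSimplex ℝ (Fin K)
  sub : ∀ p ∈ E, p ∈ P
  prob : ∀ a, IsProbabilityMeasure (ν a)
  supp : ∀ a, ν a (Set.Icc 0 1) = 1
  opt_mem : e ∈ E
  opt_eq : optPayoff P (means ν) = payoff e (means ν)
  opt_le : ∀ q ∈ P, payoff q (means ν) ≤ payoff e (means ν)
  gap_pos : 0 < Δ
  gap_le_one : Δ ≤ 1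
  gap_le : ∀ p ∈ E, 0 < gap P (means ν) p → Δ ≤ gap P (means ν) p

/-- `E` is finite, so the infimum defining the minimal gap is attained, hence positive; it is at
most 1 because payoffs lie in `[0, 1]`. -/
lemma exists_isBanditModel {P : Set (Fin K → ℝ)} {E : Finset (Fin K → ℝ)}
    (hP : P ⊆ stdSimplex ℝ (Fin K)) (hE : P = convexHull ℝ (E : Set (Fin K → ℝ)))
    {ν : Fin K → Measure ℝ} (hprob : ∀ a, IsProbabilityMeasure (ν a))
    (hν : ∀ a, ν a (Set.Icc 0 1) = 1) (hsub : ∃ p ∈ E, 0 < gap P (means ν) p) :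
    ∃ e, IsBanditModel P E ν e (minGap P E (means ν)) := by
  obtain ⟨p₀, hp₀, hgap₀⟩ := hsub
  obtain ⟨e, he, hopt, hle⟩ := exists_optimal_mem hE ⟨p₀, hp₀⟩ (means ν)
  have hEP : ∀ p ∈ E, p ∈ P := fun p hp => hE ▸ subset_convexHull ℝ _ hp
  have hfin : {x | ∃ p ∈ E, 0 < gap P (means ν) p ∧ x = gap P (means ν) p}.Finite := by
    refine (E.image (gap P (means ν))).finite_toSet.subset ?_
    rintro _ ⟨p, hp, -, rfl⟩
    exact Finset.mem_coe.2 (Finset.mem_image_of_mem _ hp)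
  have hmin : ∀ p ∈ E, 0 < gap P (means ν) p → minGap P E (means ν) ≤ gap P (means ν) p :=
    fun p hp h => csInf_le hfin.bddBelow ⟨p, hp, h, rfl⟩
  have hμ := means_mem_Icc hprob hν
  obtain ⟨p₁, -, hpos, heq⟩ := Set.Nonempty.csInf_mem
    (s := {x | ∃ p ∈ E, 0 < gap P (means ν) p ∧ x = gap P (means ν) p})
    ⟨_, p₀, hp₀, hgap₀, rfl⟩ hfin
  refine ⟨e, hP, hEP, hprob, hν, he, hopt, hle, ?_, (hmin p₀ hp₀ hgap₀).trans ?_, hmin⟩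
  · rw [minGap, heq]; exact hpos
  · rw [gap, hopt]
    linarith [payoff_le_one (hP (hEP e he)) fun a => (hμ a).2,
      payoff_nonneg (hP (hEP p₀ hp₀)).1 fun a => (hμ a).1]

namespace IsBanditModel

variable {P : Set (Fin K → ℝ)} {E : Finset (Fin K → ℝ)} {ν : Fin K → Measure ℝ}
  {e : Fin K → ℝ} {Δ : ℝ}

lemma gap_nonneg (h : IsBanditModel P E ν e Δ) {p : Fin K → ℝ} (hp : p ∈ P) :
    0 ≤ gap P (means ν) p := by
  rw [gap, h.opt_eq]; linarith [h.opt_le p hp]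

lemma gap_le_one' (h : IsBanditModel P E ν e Δ) {p : Fin K → ℝ} (hp : p ∈ P) :
    gap P (means ν) p ≤ 1 := by
  have hμ := means_mem_Icc h.prob h.supp
  rw [gap, h.opt_eq]
  linarith [payoff_le_one (h.simplex (h.sub e h.opt_mem)) fun a => (hμ a).2,
    payoff_nonneg (h.simplex hp).1 fun a => (hμ a).1]

lemma mem_optActions (h : IsBanditModel P E ν e Δ) {p : Fin K → ℝ} (hp : p ∈ P)
    (h0 : gap P (means ν) p ≤ 0) : p ∈ optActions P (means ν) := by
  refine ⟨hp, fun q hq => ?_⟩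
  rw [gap, h.opt_eq] at h0
  linarith [h.opt_le q hq]

/-- There are at least two arms when some action is suboptimal, so that the least probability of
an arm is at most one half. -/
lemma two_mul_minProb_le (h : IsBanditModel P E ν e Δ)
    (hsub : ∃ p ∈ E, 0 < gap P (means ν) p) (hℓ : 0 < minProb P) : 2 * minProb P ≤ 1 := by
  have hsum := (h.simplex (h.sub e h.opt_mem)).2
  have hle : (K : ℝ) * minProb P ≤ 1 := by
    rw [← hsum]
    have := Finset.card_nsmul_le_sum Finset.univ e (minProb P)
      fun a _ => minProb_le h.simplex (h.sub e h.opt_mem) a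
    simpa using this
  have hK : 2 ≤ K := by
    by_contra! hlt
    obtain ⟨p, hp, hpos⟩ := hsub
    have hsump := (h.simplex (h.sub p hp)).2
    have : p = e := by
      interval_cases K
      · ext i; exact i.elim0
      · ext i; fin_cases i; simp at hsum hsump; simp [hsum, hsump]
    rw [this, gap, h.opt_eq] at hpos
    simp at hpos
  have hK' : (2 : ℝ) ≤ K := by exact_mod_cast hK
  nlinarith

end IsBanditModel

end Geometry


/-! ### Hoeffding's lemma, for a reward distribution and for a finite distribution -/

lemma integral_exp_sub_mean_le {α : Type*} {mα : MeasurableSpace α} (ρ : Measure α)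
    [IsProbabilityMeasure ρ] {X : α → ℝ} (hX : AEMeasurable X ρ)
    (hmem : ∀ᵐ y ∂ρ, X y ∈ Set.Icc (0 : ℝ) 1) (r : ℝ) :
    Integrable (fun y => Real.exp (r * (X y - ρ[X]))) ρ ∧
      ∫ y, Real.exp (r * (X y - ρ[X])) ∂ρ ≤ Real.exp (r ^ 2 / 8) := by
  have h := hasSubgaussianMGF_of_mem_Icc hX hmem
  refine ⟨h.integrable_exp_mul r, (h.mgf_le r).trans (le_of_eq ?_)⟩
  -- On an interval of length 1 the variance proxy is `(1/2)²`, whence the exponent `r² / 8`.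
  congr 1
  simp
  ring

lemma lintegral_exp_reward_le {K : ℕ} {ν : Fin K → Measure ℝ}
    (hprob : ∀ a, IsProbabilityMeasure (ν a)) (hν : ∀ a, ν a (Set.Icc 0 1) = 1) (a : Fin K)
    (r : ℝ) :
    ∫⁻ y, ENNReal.ofReal (Real.exp (r * (y - means ν a) - r ^ 2 / 8)) ∂(ν a) ≤ 1 := by
  have := hprob a
  obtain ⟨hint, hle⟩ := integral_exp_sub_mean_le (ν a) (X := fun y => y) aemeasurable_id
    ((mem_ae_iff_prob_eq_one measurableSet_Icc).2 (hν a)) r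
  change Integrable (fun y => Real.exp (r * (y - means ν a))) (ν a) at hint
  change ∫ y, Real.exp (r * (y - means ν a)) ∂(ν a) ≤ _ at hle
  have heq : ∀ y, Real.exp (r * (y - means ν a) - r ^ 2 / 8) =
      Real.exp (-(r ^ 2 / 8)) * Real.exp (r * (y - means ν a)) := fun y => by
    rw [← Real.exp_add]; ring_nf
  simp_rw [heq]
  rw [← ofReal_integral_eq_lintegral_ofReal (hint.const_mul _)
    (ae_of_all _ fun y => by positivity), integral_const_mul, ← ENNReal.ofReal_one]
  refine ENNReal.ofReal_le_ofReal ?_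
  calc _ ≤ Real.exp (-(r ^ 2 / 8)) * Real.exp (r ^ 2 / 8) :=
        mul_le_mul_of_nonneg_left hle (Real.exp_nonneg _)
    _ = 1 := by rw [← Real.exp_add]; simp

/-- Serves for the draw of an arm, where the weights are the mixed action at a fixed outcome `ω`. -/
lemma sum_mul_exp_sub_mean_le {ι : Type*} [Fintype ι] {w x : ι → ℝ} (hw : w ∈ stdSimplex ℝ ι)
    (hx : ∀ i, x i ∈ Set.Icc (0 : ℝ) 1) (r : ℝ) :
    ∑ i, w i * Real.exp (r * (x i - ∑ j, w j * x j)) ≤ Real.exp (r ^ 2 / 8) := by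
  let _ : MeasurableSpace ι := ⊤
  set ρ : Measure ι := ∑ i, ENNReal.ofReal (w i) • Measure.dirac i with hρ
  have hp : IsProbabilityMeasure ρ := ⟨by
    simp only [hρ, Measure.coe_finsetSum, Finset.sum_apply, Measure.smul_apply, measure_univ,
      smul_eq_mul, mul_one]
    rw [← ENNReal.ofReal_sum_of_nonneg fun i _ => hw.1 i, hw.2, ENNReal.ofReal_one]⟩
  have hint : ∀ f : ι → ℝ, ∫ i, f i ∂ρ = ∑ i, w i * f i := fun f => by
    rw [hρ, integral_finsetSum_measure]
    · refine Finset.sum_congr rfl fun i _ => ?_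
      rw [integral_smul_measure, integral_dirac, ENNReal.toReal_ofReal (hw.1 i), smul_eq_mul]
    · exact fun i _ => (integrable_dirac (by simp)).smul_measure ENNReal.ofReal_ne_top
  have := (integral_exp_sub_mean_le ρ (X := x) (measurable_of_finite x).aemeasurable
    (ae_of_all _ hx) r).2
  rwa [hint, hint] at this

/-! ### Integrals against a sub-sigma-algebra -/

/-- The measures with densities `f` and `g` have the same trace on `m`, so they integrate
`m`-measurable functions alike. Working with nonnegative functions avoids any integrability
condition on the weight `H`. -/
lemma lintegral_mul_eq_of_setLIntegral_eq {Ω : Type*} {m mΩ : MeasurableSpace Ω}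
    {Pr : Measure Ω} (hm : m ≤ mΩ) {f g : Ω → ℝ≥0∞} (hf : Measurable f) (hg : Measurable g)
    (hfg : ∀ F, MeasurableSet[m] F → ∫⁻ ω in F, f ω ∂Pr = ∫⁻ ω in F, g ω ∂Pr)
    {H : Ω → ℝ≥0∞} (hH : Measurable[m] H) :
    ∫⁻ ω, H ω * f ω ∂Pr = ∫⁻ ω, H ω * g ω ∂Pr := by
  have key : (Pr.withDensity f).trim hm = (Pr.withDensity g).trim hm := by
    refine @Measure.ext _ m _ _ fun F hF => ?_
    rw [trim_measurableSet_eq hm hF, trim_measurableSet_eq hm hF, withDensity_apply _ (hm F hF),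
      withDensity_apply _ (hm F hF), hfg F hF]
  have hH' : Measurable H := hH.mono hm le_rfl
  have e : ∀ {k : Ω → ℝ≥0∞}, Measurable k →
      ∫⁻ ω, H ω * k ω ∂Pr = ∫⁻ ω, H ω ∂((Pr.withDensity k).trim hm) := fun {k} hk => by
    rw [lintegral_trim hm hH, lintegral_withDensity_eq_lintegral_mul _ hk hH']
    simp [mul_comm]
  rw [e hf, e hg, key]

/-! ### Conditional laws along the protocol -/

section Protocol

variable {Ω : Type*} {mΩ : MeasurableSpace Ω} {K : ℕ} {P : Set (Fin K → ℝ)}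
  {ν : Fin K → Measure ℝ} {Pr : Measure Ω} {ℱ : Filtration ℕ mΩ}
  {p : ℕ → Ω → Fin K → ℝ} {A : ℕ → Ω → Fin K} {Y : ℕ → Ω → ℝ}

namespace IsProtocol

lemma measurable_coord (h : IsProtocol P ν Pr ℱ p A Y) (t : ℕ) (a : Fin K) :
    Measurable[ℱ t] fun ω => p (t + 1) ω a :=
  (measurable_pi_apply a).comp (h.measurable_action t)

lemma measurableSet_arm (h : IsProtocol P ν Pr ℱ p A Y) (t : ℕ) (a : Fin K) :
    MeasurableSet[ℱ (t + 1)] (A (t + 1) ⁻¹' {a}) :=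
  h.measurable_arm t (measurableSet_singleton a)

lemma measure_inter_arm_reward (h : IsProtocol P ν Pr ℱ p A Y) [IsProbabilityMeasure Pr]
    (hP : P ⊆ stdSimplex ℝ (Fin K)) (hprob : ∀ a, IsProbabilityMeasure (ν a)) (t : ℕ)
    (a : Fin K) {F : Set Ω} (hF : MeasurableSet[ℱ t] F) {B : Set ℝ} (hB : MeasurableSet B) :
    Pr (F ∩ (A (t + 1) ⁻¹' {a} ∩ Y (t + 1) ⁻¹' B)) =
      (∫⁻ ω in F, ENNReal.ofReal (p (t + 1) ω a) ∂Pr) * ν a B := by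
  have := hprob a
  have hF' : MeasurableSet F := ℱ.le t F hF
  set S := A (t + 1) ⁻¹' {a} ∩ Y (t + 1) ⁻¹' B with hSdef
  have hS : MeasurableSet S := ((ℱ.le (t + 1) _ (h.measurableSet_arm t a))).inter
    (ℱ.le (t + 1) _ (h.measurable_reward t hB))
  have hi : Integrable (S.indicator fun _ => (1 : ℝ)) Pr := (integrable_const 1).indicator hS
  have h1 := setIntegral_condExp (ℱ.le t) hi hF
  rw [setIntegral_congr_ae hF' ((h.cond_law t a B hB).mono fun ω hω _ => hω),
    integral_mul_const, setIntegral_indicator hS, setIntegral_const, smul_eq_mul, mul_one] at h1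
  have hp0 : ∀ ω, 0 ≤ p (t + 1) ω a := fun ω => (hP (h.mem t ω)).1 a
  have hp1 : ∀ ω, p (t + 1) ω a ≤ 1 := fun ω => by
    rw [← (hP (h.mem t ω)).2]
    exact Finset.single_le_sum (fun b _ => (hP (h.mem t ω)).1 b) (Finset.mem_univ a)
  have hpm : Measurable fun ω => p (t + 1) ω a := (h.measurable_coord t a).mono (ℱ.le t) le_rfl
  have hpi : Integrable (fun ω => p (t + 1) ω a) (Pr.restrict F) :=
    Integrable.of_mem_Icc 0 1 hpm.aemeasurable (ae_of_all _ fun ω => ⟨hp0 ω, hp1 ω⟩)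
  rw [← ofReal_integral_eq_lintegral_ofReal hpi (ae_of_all _ hp0), ← ofReal_measureReal,
    ← h1, ENNReal.ofReal_mul (integral_nonneg hp0), ofReal_measureReal]

/-- Integrating a function of the past times a function of the arm and reward of the next round. -/
lemma lintegral_mul_indicator_arm (h : IsProtocol P ν Pr ℱ p A Y) [IsProbabilityMeasure Pr]
    (hP : P ⊆ stdSimplex ℝ (Fin K)) (hprob : ∀ a, IsProbabilityMeasure (ν a)) (t : ℕ)
    (a : Fin K) {H : Ω → ℝ≥0∞} (hH : Measurable[ℱ t] H) {g : ℝ → ℝ≥0∞} (hg : Measurable g) :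
    ∫⁻ ω, H ω * (A (t + 1) ⁻¹' {a}).indicator (fun ω => g (Y (t + 1) ω)) ω ∂Pr =
      ∫⁻ ω, H ω * (ENNReal.ofReal (p (t + 1) ω a) * ∫⁻ y, g y ∂(ν a)) ∂Pr := by
  have := hprob a
  have hA : MeasurableSet (A (t + 1) ⁻¹' {a}) := ℱ.le (t + 1) _ (h.measurableSet_arm t a)
  have hY : Measurable (Y (t + 1)) := (h.measurable_reward t).mono (ℱ.le (t + 1)) le_rfl
  have hpm : Measurable fun ω => p (t + 1) ω a := (h.measurable_coord t a).mono (ℱ.le t) le_rfl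
  refine lintegral_mul_eq_of_setLIntegral_eq (ℱ.le t) ((hg.comp hY).indicator hA)
    (hpm.ennreal_ofReal.mul_const _) (fun F hF => ?_) hH
  have hF' : MeasurableSet F := ℱ.le t F hF
  -- On a past event intersected with the draw of `a`, the law of the reward is a multiple of `ν a`;
  -- this extends the conditional law from sets to functions `g`.
  have hmap : (Pr.restrict (F ∩ A (t + 1) ⁻¹' {a})).map (Y (t + 1)) =
      (∫⁻ ω in F, ENNReal.ofReal (p (t + 1) ω a) ∂Pr) • ν a := by
    refine Measure.ext fun B hB => ?_
    rw [Measure.map_apply hY hB, Measure.restrict_apply (hY hB), Measure.smul_apply, smul_eq_mul,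
      ← h.measure_inter_arm_reward hP hprob t a hF hB]
    congr 1
    ext ω
    simp only [Set.mem_inter_iff]
    tauto
  rw [setLIntegral_indicator hA, Set.inter_comm, lintegral_mul_const _ hpm.ennreal_ofReal,
    ← smul_eq_mul, ← lintegral_smul_measure, ← hmap, lintegral_map hg hY]
  rfl

/-- The one-step inequality behind both exponential supermartingales below: `H` carries the past,
`g` the new reward, and both may depend on the arm drawn. -/
lemma lintegral_next_le (h : IsProtocol P ν Pr ℱ p A Y) [IsProbabilityMeasure Pr]
    (hP : P ⊆ stdSimplex ℝ (Fin K)) (hprob : ∀ a, IsProbabilityMeasure (ν a)) (t : ℕ)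
    {H : Fin K → Ω → ℝ≥0∞} (hH : ∀ b, Measurable[ℱ t] (H b))
    {g : Fin K → ℝ → ℝ≥0∞} (hg : ∀ b, Measurable (g b)) {M : Ω → ℝ≥0∞}
    (hM : ∀ ω, ∑ b, H b ω * (ENNReal.ofReal (p (t + 1) ω b) * ∫⁻ y, g b y ∂(ν b)) ≤ M ω) :
    ∫⁻ ω, H (A (t + 1) ω) ω * g (A (t + 1) ω) (Y (t + 1) ω) ∂Pr ≤ ∫⁻ ω, M ω ∂Pr := by
  have hY : Measurable (Y (t + 1)) := (h.measurable_reward t).mono (ℱ.le (t + 1)) le_rfl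
  have hsplit : ∀ ω, H (A (t + 1) ω) ω * g (A (t + 1) ω) (Y (t + 1) ω) =
      ∑ b, H b ω * (A (t + 1) ⁻¹' {b}).indicator (fun ω => g b (Y (t + 1) ω)) ω := fun ω => by
    rw [Finset.sum_eq_single (A (t + 1) ω)]
    · simp
    · intro b _ hb
      simp [Set.indicator, hb.symm]
    · simp
  simp_rw [hsplit]
  rw [lintegral_finsetSum]
  · simp_rw [h.lintegral_mul_indicator_arm hP hprob t _ (hH _) (hg _)]
    rw [← lintegral_finsetSum]
    · exact lintegral_mono hM
    · exact fun b _ => ((hH b).mono (ℱ.le t) le_rfl).mul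
        (((h.measurable_coord t b).mono (ℱ.le t) le_rfl).ennreal_ofReal.mul_const _)
  · exact fun b _ => ((hH b).mono (ℱ.le t) le_rfl).mul
      (((hg b).comp hY).indicator (ℱ.le (t + 1) _ (h.measurableSet_arm t b)))

end IsProtocol

/-! ### The counts and the centred sums of rewards -/

/-- The sum of the centred rewards obtained from arm `a` in rounds `1, …, t`. -/
noncomputable def noise (ν : Fin K → Measure ℝ) (A : ℕ → Ω → Fin K) (Y : ℕ → Ω → ℝ)
    (a : Fin K) (t : ℕ) (ω : Ω) : ℝ :=
  ∑ s ∈ (Finset.Icc 1 t).filter (fun s => A s ω = a), (Y s ω - means ν a)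

lemma pulls_zero (a : Fin K) (ω : Ω) : pulls A a 0 ω = 0 := by simp [pulls]

lemma pulls_succ (a : Fin K) (t : ℕ) (ω : Ω) :
    pulls A a (t + 1) ω = pulls A a t ω + if A (t + 1) ω = a then 1 else 0 := by
  rw [pulls, pulls, ← Finset.insert_Icc_right_eq_Icc_add_one (by omega), Finset.filter_insert]
  split_ifs with hA
  · rw [Finset.card_insert_of_notMem (by simp)]
  · simp

lemma noise_succ (a : Fin K) (t : ℕ) (ω : Ω) :
    noise ν A Y a (t + 1) ω = noise ν A Y a t ω +
      if A (t + 1) ω = a then Y (t + 1) ω - means ν a else 0 := by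
  rw [noise, noise, ← Finset.insert_Icc_right_eq_Icc_add_one (by omega), Finset.filter_insert]
  split_ifs with hA
  · rw [Finset.sum_insert (by simp), add_comm]
  · simp

lemma pulls_le (a : Fin K) (t : ℕ) (ω : Ω) : pulls A a t ω ≤ t :=
  (Finset.card_filter_le _ _).trans (by simp)

lemma sum_reward_eq (a : Fin K) (t : ℕ) (ω : Ω) :
    ∑ s ∈ (Finset.Icc 1 t).filter (fun s => A s ω = a), Y s ω =
      noise ν A Y a t ω + pulls A a t ω * means ν a := by
  simp [noise, pulls, Finset.sum_sub_distrib]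

lemma IsProtocol.measurable_pulls (h : IsProtocol P ν Pr ℱ p A Y) (a : Fin K) (t : ℕ) :
    Measurable[ℱ t] (pulls A a t) := by
  induction t with
  | zero => rw [funext (pulls_zero a)]; exact measurable_const
  | succ t ih =>
    rw [funext (pulls_succ a t)]
    exact (ih.mono (ℱ.mono t.le_succ) le_rfl).add
      (Measurable.ite (h.measurableSet_arm t a) measurable_const measurable_const)

lemma IsProtocol.measurable_noise (h : IsProtocol P ν Pr ℱ p A Y) (a : Fin K) (t : ℕ) :
    Measurable[ℱ t] (noise ν A Y a t) := by
  induction t with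
  | zero =>
    rw [show noise ν A Y a 0 = fun _ => 0 from funext fun ω => by simp [noise]]
    exact measurable_const
  | succ t ih =>
    rw [funext (noise_succ a t)]
    exact (ih.mono (ℱ.mono t.le_succ) le_rfl).add
      (Measurable.ite (h.measurableSet_arm t a)
        ((h.measurable_reward t).sub_const _) measurable_const)

end Protocol


/-! ### Exponential supermartingales and deviation inequalities. -/

section Tails

variable {Ω : Type*} {mΩ : MeasurableSpace Ω} {K : ℕ} {P : Set (Fin K → ℝ)}
  {ν : Fin K → Measure ℝ} {Pr : Measure Ω} {ℱ : Filtration ℕ mΩ}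
  {p : ℕ → Ω → Fin K → ℝ} {A : ℕ → Ω → Fin K} {Y : ℕ → Ω → ℝ}

/-- Chernoff's bound. -/
lemma measureReal_le_exp_neg [IsProbabilityMeasure Pr] {f : Ω → ℝ} (hf : Measurable f)
    (h1 : ∫⁻ ω, ENNReal.ofReal (Real.exp (f ω)) ∂Pr ≤ 1) {S : Set Ω} {x : ℝ}
    (hS : ∀ ω ∈ S, x ≤ f ω) : Pr.real S ≤ Real.exp (-x) := by
  have hsub : S ⊆ {ω | ENNReal.ofReal (Real.exp x) ≤ ENNReal.ofReal (Real.exp (f ω))} :=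
    fun ω hω => ENNReal.ofReal_le_ofReal (Real.exp_le_exp.2 (hS ω hω))
  have hm := mul_meas_ge_le_lintegral (μ := Pr) (f := fun ω => ENNReal.ofReal (Real.exp (f ω)))
    (Real.measurable_exp.comp hf).ennreal_ofReal (ENNReal.ofReal (Real.exp x))
  have h2 : ENNReal.ofReal (Real.exp x) * Pr S ≤ 1 :=
    (mul_le_mul_right (measure_mono hsub) _).trans (hm.trans h1)
  have h3 : Real.exp x * Pr.real S ≤ 1 := by
    have := ENNReal.toReal_mono ENNReal.one_ne_top h2
    rwa [ENNReal.toReal_mul, ENNReal.toReal_ofReal (Real.exp_nonneg _), ENNReal.toReal_one] at this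
  rw [Real.exp_neg, ← one_div, le_div_iff₀ (Real.exp_pos x), mul_comm]
  exact h3

namespace IsProtocol

/-- A draw of `a` multiplies the exponential by a factor of conditional mean at most 1, and any
other draw leaves it unchanged. The compensator therefore involves the count of `a` rather than `t`.
-/
lemma lintegral_exp_noise_le_one (h : IsProtocol P ν Pr ℱ p A Y) [IsProbabilityMeasure Pr]
    (hP : P ⊆ stdSimplex ℝ (Fin K)) (hprob : ∀ a, IsProbabilityMeasure (ν a))
    (hν : ∀ a, ν a (Set.Icc 0 1) = 1) (a : Fin K) (r : ℝ) (t : ℕ) :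
    ∫⁻ ω, ENNReal.ofReal (Real.exp (r * noise ν A Y a t ω - r ^ 2 / 8 * pulls A a t ω)) ∂Pr
      ≤ 1 := by
  induction t with
  | zero => simp [noise, pulls]
  | succ t ih =>
    set M : Ω → ℝ≥0∞ := fun ω =>
      ENNReal.ofReal (Real.exp (r * noise ν A Y a t ω - r ^ 2 / 8 * pulls A a t ω)) with hMdef
    set g : Fin K → ℝ → ℝ≥0∞ := fun b y =>
      if b = a then ENNReal.ofReal (Real.exp (r * (y - means ν a) - r ^ 2 / 8)) else 1 with hgdef
    have hM : Measurable[ℱ t] M :=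
      (Real.measurable_exp.comp (((h.measurable_noise a t).const_mul r).sub
        (((measurable_from_top (f := fun n : ℕ => (n : ℝ))).comp
          (h.measurable_pulls a t)).const_mul _))).ennreal_ofReal
    have hg : ∀ b, Measurable (g b) := fun b => by
      by_cases hb : b = a
      · simp only [hgdef, hb, if_true]; fun_prop
      · simp only [hgdef, hb, if_false]; fun_prop
    have hg1 : ∀ b, ∫⁻ y, g b y ∂(ν b) ≤ 1 := fun b => by
      have := hprob b
      by_cases hb : b = a
      · subst hb; simpa [hgdef] using lintegral_exp_reward_le hprob hν b r
      · simp [hgdef, hb]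
    have heq : ∀ ω, ENNReal.ofReal (Real.exp (r * noise ν A Y a (t + 1) ω -
        r ^ 2 / 8 * pulls A a (t + 1) ω)) = M ω * g (A (t + 1) ω) (Y (t + 1) ω) := fun ω => by
      simp only [hMdef, hgdef, noise_succ, pulls_succ]
      split_ifs with hA
      · rw [← ENNReal.ofReal_mul (Real.exp_nonneg _), ← Real.exp_add]
        push_cast
        ring_nf
      · simp
    simp_rw [heq]
    refine (h.lintegral_next_le hP hprob t (H := fun _ => M) (fun _ => hM) hg
      (M := M) fun ω => ?_).trans ih
    rw [← Finset.mul_sum]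
    refine mul_le_of_le_one_right' ?_
    have hs := hP (h.mem t ω)
    calc _ ≤ ∑ b, ENNReal.ofReal (p (t + 1) ω b) :=
          Finset.sum_le_sum fun b _ => mul_le_of_le_one_right' (hg1 b)
      _ = 1 := by rw [← ENNReal.ofReal_sum_of_nonneg fun b _ => hs.1 b, hs.2, ENNReal.ofReal_one]

end IsProtocol

/-- The event that the average reward of arm `a` after `t` rounds deviates from its mean, in the
direction given by the sign `σ`, by at least `c` times the bonus of the algorithm. -/
def deviation (ν : Fin K → Measure ℝ) (A : ℕ → Ω → Fin K) (Y : ℕ → Ω → ℝ) (σ c : ℝ) (a : Fin K)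
    (t : ℕ) : Set Ω :=
  {ω | 1 ≤ pulls A a t ω ∧
    c * Real.sqrt (2 * Real.log t * pulls A a t ω) ≤ σ * noise ν A Y a t ω}

lemma IsProtocol.measurableSet_deviation (h : IsProtocol P ν Pr ℱ p A Y) (σ c : ℝ) (a : Fin K)
    (t : ℕ) : MeasurableSet (deviation ν A Y σ c a t) := by
  have h1 : Measurable (pulls A a t) := (h.measurable_pulls a t).mono (ℱ.le t) le_rfl
  have h2 : Measurable (noise ν A Y a t) := (h.measurable_noise a t).mono (ℱ.le t) le_rfl
  have h3 : Measurable fun ω => (pulls A a t ω : ℝ) := measurable_from_top.comp h1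
  refine (measurableSet_le measurable_const h1).inter (measurableSet_le ?_ (h2.const_mul σ))
  exact (Real.continuous_sqrt.measurable.comp (h3.const_mul _)).const_mul c

/-- The count is random, so a union bound runs over its `t` possible values; each of them
contributes `t ^ (-4c²)` by Chernoff's bound. -/
lemma IsProtocol.measureReal_deviation_le (h : IsProtocol P ν Pr ℱ p A Y)
    [IsProbabilityMeasure Pr] (hP : P ⊆ stdSimplex ℝ (Fin K))
    (hprob : ∀ a, IsProbabilityMeasure (ν a)) (hν : ∀ a, ν a (Set.Icc 0 1) = 1)
    {σ c : ℝ} (hσ : σ ^ 2 = 1) (hc : 0 ≤ c) (a : Fin K) {t : ℕ} (ht : 1 ≤ t) :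
    Pr.real (deviation ν A Y σ c a t) ≤ (t : ℝ) ^ (1 - 4 * c ^ 2) := by
  have ht0 : (0 : ℝ) < t := by exact_mod_cast ht
  have hlog : 0 ≤ Real.log t := Real.log_nonneg (by exact_mod_cast ht)
  set S : ℕ → Set Ω := fun n => {ω | pulls A a t ω = n ∧
    c * Real.sqrt (2 * Real.log t * n) ≤ σ * noise ν A Y a t ω}
  have hsub : deviation ν A Y σ c a t ⊆ ⋃ n ∈ Finset.Icc 1 t, S n := fun ω hω => by
    simp only [Set.mem_iUnion]
    exact ⟨pulls A a t ω, Finset.mem_Icc.2 ⟨hω.1, pulls_le a t ω⟩, rfl, hω.2⟩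
  have hn : ∀ n ∈ Finset.Icc 1 t, Pr.real (S n) ≤ Real.exp (-(4 * c ^ 2 * Real.log t)) := by
    intro n hn
    have hn0 : (0 : ℝ) < n := by exact_mod_cast (Finset.mem_Icc.1 hn).1
    set w := Real.sqrt (2 * Real.log t * n) with hw
    have hw2 : w ^ 2 = 2 * Real.log t * n := Real.sq_sqrt (by positivity)
    have hwnn : 0 ≤ w := Real.sqrt_nonneg _
    have hm1 : Measurable (noise ν A Y a t) := (h.measurable_noise a t).mono (ℱ.le t) le_rfl
    have hm2 : Measurable fun ω => (pulls A a t ω : ℝ) :=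
      measurable_from_top.comp ((h.measurable_pulls a t).mono (ℱ.le t) le_rfl)
    -- With the threshold `x = c * w`, the parameter `4x/n` maximizes `r x - r² n / 8`; the factor
    -- `σ` selects the tail.
    refine measureReal_le_exp_neg (((hm1.const_mul _).sub (hm2.const_mul _)))
      (h.lintegral_exp_noise_le_one hP hprob hν a (σ * (4 * (c * w / n))) t) ?_
    rintro ω ⟨hω1, hω2⟩
    have e1 : σ * (4 * (c * w / n)) * noise ν A Y a t ω
        = 4 * (c * w / n) * (σ * noise ν A Y a t ω) := by ring
    have e2 : (σ * (4 * (c * w / n))) ^ 2 / 8 * n = 2 * c ^ 2 * (w ^ 2 / n) := by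
      rw [mul_pow, hσ]; field_simp; ring
    have e3 : 4 * (c * w / n) * (c * w) = 4 * c ^ 2 * (w ^ 2 / n) := by field_simp
    have e4 : w ^ 2 / n = 2 * Real.log t := by rw [hw2]; field_simp
    have := mul_le_mul_of_nonneg_left hω2 (by positivity : 0 ≤ 4 * (c * w / n))
    change _ ≤ σ * (4 * (c * w / n)) * noise ν A Y a t ω -
      (σ * (4 * (c * w / n))) ^ 2 / 8 * pulls A a t ω
    rw [hω1, e1, e2, e4]
    rw [← hw, e3, e4] at this
    linarith
  calc Pr.real (deviation ν A Y σ c a t) ≤ Pr.real (⋃ n ∈ Finset.Icc 1 t, S n) :=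
        measureReal_mono hsub (measure_ne_top _ _)
    _ ≤ ∑ n ∈ Finset.Icc 1 t, Pr.real (S n) := measureReal_biUnion_finset_le _ _
    _ ≤ ∑ n ∈ Finset.Icc 1 t, Real.exp (-(4 * c ^ 2 * Real.log t)) := Finset.sum_le_sum hn
    _ = (t : ℝ) ^ (1 - 4 * c ^ 2) := by
        rw [Finset.sum_const, Nat.card_Icc, Real.rpow_sub ht0, Real.rpow_one,
          Real.rpow_def_of_pos ht0, Real.exp_neg, nsmul_eq_mul]
        simp [mul_comm, div_eq_mul_inv]

/-! ### The Azuma–Hoeffding inequality for predictable weights -/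

/-- The difference between the predictable and the realized weighted counts of arm `a`. -/
noncomputable def drift (p : ℕ → Ω → Fin K → ℝ) (A : ℕ → Ω → Fin K) (a : Fin K) (H : ℕ → Ω → ℝ)
    (t : ℕ) (ω : Ω) : ℝ :=
  ∑ s ∈ Finset.range t, H s ω * (p (s + 1) ω a - if A (s + 1) ω = a then 1 else 0)

namespace IsProtocol

lemma measurable_drift (h : IsProtocol P ν Pr ℱ p A Y) (a : Fin K) {H : ℕ → Ω → ℝ}
    (hH : ∀ s, Measurable[ℱ s] (H s)) (t : ℕ) : Measurable[ℱ t] (drift p A a H t) := by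
  refine Finset.measurable_fun_sum _ fun s hs => ?_
  have hst : s + 1 ≤ t := Finset.mem_range.1 hs
  exact ((hH s).mono (ℱ.mono (by omega)) le_rfl).mul
    (((h.measurable_coord s a).mono (ℱ.mono (by omega)) le_rfl).sub
      (Measurable.ite (ℱ.mono hst _ (h.measurableSet_arm s a)) measurable_const measurable_const))

/-- Given the past, the increment is minus a centred variable with values in `[0, 1]`, namely `H t`
times the indicator of the draw; hence Hoeffding's lemma is applied at `-r`. -/
lemma lintegral_exp_drift_le_one (h : IsProtocol P ν Pr ℱ p A Y) [IsProbabilityMeasure Pr]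
    (hP : P ⊆ stdSimplex ℝ (Fin K)) (hprob : ∀ a, IsProbabilityMeasure (ν a)) (a : Fin K)
    {H : ℕ → Ω → ℝ} (hH : ∀ s, Measurable[ℱ s] (H s))
    (hH01 : ∀ s ω, H s ω ∈ Set.Icc (0 : ℝ) 1) (r : ℝ) (t : ℕ) :
    ∫⁻ ω, ENNReal.ofReal (Real.exp (r * drift p A a H t ω - r ^ 2 / 8 * t)) ∂Pr ≤ 1 := by
  induction t with
  | zero => simp [drift]
  | succ t ih =>
    set M : Ω → ℝ≥0∞ := fun ω =>
      ENNReal.ofReal (Real.exp (r * drift p A a H t ω - r ^ 2 / 8 * t)) with hMdef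
    set J : Fin K → Ω → ℝ := fun b ω =>
      Real.exp (r * (H t ω * (p (t + 1) ω a - if b = a then 1 else 0)) - r ^ 2 / 8) with hJdef
    have hM : Measurable[ℱ t] M :=
      (Real.measurable_exp.comp (((h.measurable_drift a hH t).const_mul r).sub_const
        _)).ennreal_ofReal
    have hJ : ∀ b, Measurable[ℱ t] (J b) := fun b =>
      Real.measurable_exp.comp ((((hH t).mul
        ((h.measurable_coord t a).sub_const _)).const_mul r).sub_const _)
    have heq : ∀ ω, ENNReal.ofReal (Real.exp (r * drift p A a H (t + 1) ω -
        r ^ 2 / 8 * (t + 1 : ℕ))) =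
        (M ω * ENNReal.ofReal (J (A (t + 1) ω) ω)) * 1 := fun ω => by
      simp only [hMdef, hJdef, drift, Finset.sum_range_succ]
      rw [mul_one, ← ENNReal.ofReal_mul (Real.exp_nonneg _), ← Real.exp_add]
      push_cast
      ring_nf
    simp_rw [heq]
    refine (h.lintegral_next_le hP hprob t
      (H := fun b ω => M ω * ENNReal.ofReal (J b ω))
      (fun b => hM.mul (hJ b).ennreal_ofReal) (g := fun _ _ => 1) (fun _ => measurable_const)
      (M := M) fun ω => ?_).trans ih
    have hs := hP (h.mem t ω)
    have hone : ∀ b, ∫⁻ _, 1 ∂(ν b) = 1 := fun b => by have := hprob b; simp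
    simp_rw [hone, mul_one, mul_assoc]
    rw [← Finset.mul_sum]
    refine mul_le_of_le_one_right' ?_
    have hconv : ∀ b, ENNReal.ofReal (J b ω) * ENNReal.ofReal (p (t + 1) ω b) =
        ENNReal.ofReal (p (t + 1) ω b * J b ω) := fun b => by
      rw [mul_comm, ENNReal.ofReal_mul (hs.1 b)]
    simp_rw [hconv]
    rw [← ENNReal.ofReal_sum_of_nonneg fun b _ => mul_nonneg (hs.1 b) (Real.exp_nonneg _),
      ← ENNReal.ofReal_one]
    refine ENNReal.ofReal_le_ofReal ?_
    have hx : ∀ b, (if b = a then H t ω else 0) ∈ Set.Icc (0 : ℝ) 1 := fun b => by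
      split_ifs
      · exact hH01 t ω
      · simp
    have hoeff := sum_mul_exp_sub_mean_le hs hx (-r)
    have hmean : ∑ b, p (t + 1) ω b * (if b = a then H t ω else 0) = p (t + 1) ω a * H t ω := by
      simp
    rw [hmean] at hoeff
    calc ∑ b, p (t + 1) ω b * J b ω = Real.exp (-(r ^ 2 / 8)) * ∑ b, p (t + 1) ω b *
          Real.exp (-r * ((if b = a then H t ω else 0) - p (t + 1) ω a * H t ω)) := by
          rw [Finset.mul_sum]
          refine Finset.sum_congr rfl fun b _ => ?_
          rw [mul_left_comm, ← Real.exp_add]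
          simp only [hJdef]
          congr 2
          split_ifs <;> ring
      _ ≤ Real.exp (-(r ^ 2 / 8)) * Real.exp ((-r) ^ 2 / 8) :=
          mul_le_mul_of_nonneg_left hoeff (Real.exp_nonneg _)
      _ = 1 := by rw [← Real.exp_add]; simp

lemma measureReal_drift_ge_le (h : IsProtocol P ν Pr ℱ p A Y) [IsProbabilityMeasure Pr]
    (hP : P ⊆ stdSimplex ℝ (Fin K)) (hprob : ∀ a, IsProbabilityMeasure (ν a)) (a : Fin K)
    {H : ℕ → Ω → ℝ} (hH : ∀ s, Measurable[ℱ s] (H s))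
    (hH01 : ∀ s ω, H s ω ∈ Set.Icc (0 : ℝ) 1) {t : ℕ} (ht : 1 ≤ t) {u : ℝ} (hu : 0 ≤ u) :
    Pr.real {ω | u ≤ drift p A a H t ω} ≤ Real.exp (-(2 * u ^ 2 / t)) := by
  have ht0 : (0 : ℝ) < t := by exact_mod_cast ht
  have hm : Measurable (drift p A a H t) := (h.measurable_drift a hH t).mono (ℱ.le t) le_rfl
  -- The parameter `4u/t` maximizes `r u - r² t / 8`.
  refine measureReal_le_exp_neg ((hm.const_mul _).sub_const _)
    (h.lintegral_exp_drift_le_one hP hprob a hH hH01 (4 * u / t) t) fun ω hω => ?_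
  have := mul_le_mul_of_nonneg_left (show u ≤ drift p A a H t ω from hω) (by positivity : 0 ≤ 4 * u / t)
  have e : (4 * u / t) ^ 2 / 8 * t = 2 * u ^ 2 / t := by field_simp; ring
  have e' : 4 * u / t * u = 4 * u ^ 2 / t := by ring
  rw [e]
  rw [e'] at this
  have e'' : 4 * u ^ 2 / t = 2 * u ^ 2 / t + 2 * u ^ 2 / t := by ring
  linarith

end IsProtocol

end Tails


section Regret

variable {Ω : Type*} {mΩ : MeasurableSpace Ω} {K : ℕ} {P : Set (Fin K → ℝ)}
  {ν : Fin K → Measure ℝ} {Pr : Measure Ω} {ℱ : Filtration ℕ mΩ}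
  {p : ℕ → Ω → Fin K → ℝ} {A : ℕ → Ω → Fin K} {Y : ℕ → Ω → ℝ}
  {E : Finset (Fin K → ℝ)} {e : Fin K → ℝ} {Δ : ℝ}

/-! ### Regret as a sum of expected gaps -/

lemma IsProtocol.measurable_payoff (h : IsProtocol P ν Pr ℱ p A Y) (μ : Fin K → ℝ) (t : ℕ) :
    Measurable fun ω => payoff (p (t + 1) ω) μ :=
  Finset.measurable_fun_sum _ fun a _ =>
    ((h.measurable_coord t a).mono (ℱ.le t) le_rfl).mul_const _

lemma IsProtocol.integrable_gap (h : IsProtocol P ν Pr ℱ p A Y) [IsProbabilityMeasure Pr]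
    (hB : IsBanditModel P E ν e Δ) (t : ℕ) :
    Integrable (fun ω => gap P (means ν) (p (t + 1) ω)) Pr :=
  Integrable.of_mem_Icc 0 1 ((h.measurable_payoff (means ν) t).const_sub _).aemeasurable
    (ae_of_all _ fun ω => ⟨hB.gap_nonneg (h.mem t ω), hB.gap_le_one' (h.mem t ω)⟩)

lemma IsProtocol.integrable_payoff (h : IsProtocol P ν Pr ℱ p A Y) [IsProbabilityMeasure Pr]
    (hB : IsBanditModel P E ν e Δ) (t : ℕ) :
    Integrable (fun ω => payoff (p (t + 1) ω) (means ν)) Pr := by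
  have hμ := means_mem_Icc hB.prob hB.supp
  exact Integrable.of_mem_Icc 0 1 (h.measurable_payoff (means ν) t).aemeasurable
    (ae_of_all _ fun ω => ⟨payoff_nonneg (hB.simplex (h.mem t ω)).1 fun a => (hμ a).1,
      payoff_le_one (hB.simplex (h.mem t ω)) fun a => (hμ a).2⟩)

lemma IsProtocol.regret_succ (h : IsProtocol P ν Pr ℱ p A Y) [IsProbabilityMeasure Pr]
    (hB : IsBanditModel P E ν e Δ) (T : ℕ) :
    regret P ν Pr p (T + 1) =
      regret P ν Pr p T + ∫ ω, gap P (means ν) (p (T + 1) ω) ∂Pr := by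
  have hi : Integrable (fun ω => ∑ t ∈ Finset.Icc 1 T, payoff (p t ω) (means ν)) Pr := by
    refine integrable_finsetSum _ fun t ht => ?_
    obtain ⟨s, rfl⟩ : ∃ s, t = s + 1 := ⟨t - 1, by have := (Finset.mem_Icc.1 ht).1; omega⟩
    exact h.integrable_payoff hB s
  simp only [regret, gap]
  simp_rw [Finset.sum_Icc_succ_top (Nat.le_add_left 1 T)]
  rw [integral_add hi (h.integrable_payoff hB T),
    integral_sub (integrable_const _) (h.integrable_payoff hB T)]
  simp
  ring

lemma IsProtocol.regret_eq_sum (h : IsProtocol P ν Pr ℱ p A Y) [IsProbabilityMeasure Pr]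
    (hB : IsBanditModel P E ν e Δ) (T : ℕ) :
    regret P ν Pr p T = ∑ t ∈ Finset.range T, ∫ ω, gap P (means ν) (p (t + 1) ω) ∂Pr := by
  induction T with
  | zero => simp [regret]
  | succ T ih => rw [h.regret_succ hB, ih, Finset.sum_range_succ]

/-! ### Summing a function of the counts along the draws -/

/-- The counts seen just before the successive draws of `a` are `0, 1, 2, …`, each exactly once. -/
lemma sum_ite_mul_pulls (a : Fin K) (f : ℕ → ℝ) (T : ℕ) (ω : Ω) :
    ∑ t ∈ Finset.range T, f (pulls A a t ω) * (if A (t + 1) ω = a then 1 else 0) =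
      ∑ n ∈ Finset.range (pulls A a T ω), f n := by
  induction T with
  | zero => simp [pulls_zero]
  | succ T ih =>
    rw [Finset.sum_range_succ, ih, pulls_succ]
    split_ifs with hA
    · rw [Finset.sum_range_succ, mul_one]
    · simp

/-- The coordinate `p (t + 1) a` is the conditional probability of drawing `a`, so either may
replace the other against a weight known at time `t`. -/
lemma IsProtocol.integral_mul_coord (h : IsProtocol P ν Pr ℱ p A Y) [IsProbabilityMeasure Pr]
    (hB : IsBanditModel P E ν e Δ) (a : Fin K) (t : ℕ) {f : Ω → ℝ} (hf : Measurable[ℱ t] f)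
    (hf0 : ∀ ω, 0 ≤ f ω) :
    ∫ ω, f ω * p (t + 1) ω a ∂Pr = ∫ ω, f ω * (if A (t + 1) ω = a then 1 else 0) ∂Pr := by
  have hf' : Measurable f := hf.mono (ℱ.le t) le_rfl
  have hA : MeasurableSet (A (t + 1) ⁻¹' {a}) := ℱ.le (t + 1) _ (h.measurableSet_arm t a)
  have hpm : Measurable fun ω => p (t + 1) ω a := (h.measurable_coord t a).mono (ℱ.le t) le_rfl
  have hi : Measurable fun ω => if A (t + 1) ω = a then (1 : ℝ) else 0 :=
    Measurable.ite hA measurable_const measurable_const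
  have hp0 : ∀ ω, 0 ≤ p (t + 1) ω a := fun ω => (hB.simplex (h.mem t ω)).1 a
  have := hB.prob a
  rw [integral_eq_lintegral_of_nonneg_ae (ae_of_all _ fun ω => mul_nonneg (hf0 ω) (hp0 ω))
    (hf'.mul hpm).aestronglyMeasurable, integral_eq_lintegral_of_nonneg_ae
    (ae_of_all _ fun ω => mul_nonneg (hf0 ω) (by split_ifs <;> simp))
    (hf'.mul hi).aestronglyMeasurable]
  have key := h.lintegral_mul_indicator_arm hB.simplex hB.prob t a hf.ennreal_ofReal
    (g := fun _ => 1) measurable_const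
  simp only [lintegral_const, measure_univ, mul_one] at key
  congr 1
  simp_rw [fun ω => ENNReal.ofReal_mul (q := p (t + 1) ω a) (hf0 ω)]
  rw [← key]
  refine lintegral_congr fun ω => ?_
  by_cases hAω : A (t + 1) ω = a <;> simp [hAω, Set.indicator]

lemma exists_forall_le_of_le (f : ℕ → ℝ) (T : ℕ) : ∃ C, ∀ n ≤ T, f n ≤ C :=
  ⟨∑ n ∈ Finset.range (T + 1), |f n|, fun n hn => (le_abs_self _).trans
    (Finset.single_le_sum (f := fun n => |f n|) (fun _ _ => abs_nonneg _)
      (Finset.mem_range.2 (by omega)))⟩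

lemma IsProtocol.measurable_comp_pulls (h : IsProtocol P ν Pr ℱ p A Y) (f : ℕ → ℝ) (a : Fin K)
    (t : ℕ) : Measurable[ℱ t] fun ω => f (pulls A a t ω) :=
  (measurable_from_top (f := f)).comp (h.measurable_pulls a t)

lemma IsProtocol.integrable_comp_pulls (h : IsProtocol P ν Pr ℱ p A Y) [IsProbabilityMeasure Pr]
    {f : ℕ → ℝ} (hf : ∀ n, 0 ≤ f n) (a : Fin K) (t : ℕ) :
    Integrable (fun ω => f (pulls A a t ω)) Pr := by
  obtain ⟨C, hC⟩ := exists_forall_le_of_le f t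
  exact Integrable.of_mem_Icc 0 C
    ((h.measurable_comp_pulls f a t).mono (ℱ.le t) le_rfl).aemeasurable
    (ae_of_all _ fun ω => ⟨hf _, hC _ (pulls_le a t ω)⟩)

lemma IsProtocol.integrable_comp_pulls_mul (h : IsProtocol P ν Pr ℱ p A Y)
    [IsProbabilityMeasure Pr] (hB : IsBanditModel P E ν e Δ)
    {f : ℕ → ℝ} (hf : ∀ n, 0 ≤ f n) (a : Fin K) (t : ℕ) :
    Integrable (fun ω => f (pulls A a t ω) * p (t + 1) ω a) Pr := by
  have hpm : Measurable fun ω => p (t + 1) ω a := (h.measurable_coord t a).mono (ℱ.le t) le_rfl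
  refine (h.integrable_comp_pulls hf a t).mul_bdd (c := 1) hpm.aestronglyMeasurable
    (ae_of_all _ fun ω => ?_)
  have hs := hB.simplex (h.mem t ω)
  rw [Real.norm_of_nonneg (hs.1 a), ← hs.2]
  exact Finset.single_le_sum (fun b _ => hs.1 b) (Finset.mem_univ a)

lemma IsProtocol.sum_integral_comp_pulls_mul_le (h : IsProtocol P ν Pr ℱ p A Y)
    [IsProbabilityMeasure Pr] (hB : IsBanditModel P E ν e Δ)
    {f : ℕ → ℝ} (hf : ∀ n, 0 ≤ f n) {T : ℕ} {B : ℝ}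
    (hfB : ∀ N ≤ T, ∑ n ∈ Finset.range N, f n ≤ B) (a : Fin K) :
    ∑ t ∈ Finset.range T, ∫ ω, f (pulls A a t ω) * p (t + 1) ω a ∂Pr ≤ B := by
  have hint : ∀ t, Integrable
      (fun ω => f (pulls A a t ω) * (if A (t + 1) ω = a then (1 : ℝ) else 0)) Pr := fun t => by
    refine (h.integrable_comp_pulls hf a t).mul_bdd (c := 1)
      (Measurable.ite (ℱ.le (t + 1) _ (h.measurableSet_arm t a)) measurable_const
        measurable_const).aestronglyMeasurable (ae_of_all _ fun ω => ?_)
    split_ifs <;> simp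
  calc _ = ∑ t ∈ Finset.range T,
        ∫ ω, f (pulls A a t ω) * (if A (t + 1) ω = a then 1 else 0) ∂Pr :=
        Finset.sum_congr rfl fun t _ =>
          h.integral_mul_coord hB a t (h.measurable_comp_pulls f a t) fun ω => hf _
    _ = ∫ ω, ∑ n ∈ Finset.range (pulls A a T ω), f n ∂Pr := by
        rw [← integral_finsetSum _ fun t _ => hint t]
        simp_rw [sum_ite_mul_pulls]
    _ ≤ ∫ _, B ∂Pr := by
        refine integral_mono_of_nonneg (ae_of_all _ fun ω => Finset.sum_nonneg fun n _ => hf n)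
          (integrable_const _) (ae_of_all _ fun ω => hfB _ (pulls_le a T ω))
    _ = B := by simp

/-- The regret is controlled by the probabilities of bad events, when outside of these the gap of
the action played is at most the mean of a function of the counts. -/
lemma IsProtocol.regret_le (h : IsProtocol P ν Pr ℱ p A Y) [IsProbabilityMeasure Pr]
    (hB : IsBanditModel P E ν e Δ) {f : ℕ → ℝ} (hf : ∀ n, 0 ≤ f n) {T : ℕ} {B : ℝ}
    (hfB : ∀ N ≤ T, ∑ n ∈ Finset.range N, f n ≤ B) {bad : ℕ → Set Ω}
    (hbad : ∀ t, MeasurableSet (bad t))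
    (hgap : ∀ t < T, ∀ ω ∉ bad t,
      gap P (means ν) (p (t + 1) ω) ≤ ∑ a, f (pulls A a t ω) * p (t + 1) ω a) :
    regret P ν Pr p T ≤ ∑ t ∈ Finset.range T, Pr.real (bad t) + K * B := by
  have hi : ∀ t a, Integrable (fun ω => f (pulls A a t ω) * p (t + 1) ω a) Pr := fun t a =>
    h.integrable_comp_pulls_mul hB hf a t
  have hstep : ∀ t ∈ Finset.range T, ∫ ω, gap P (means ν) (p (t + 1) ω) ∂Pr ≤
      Pr.real (bad t) + ∑ a, ∫ ω, f (pulls A a t ω) * p (t + 1) ω a ∂Pr := by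
    intro t ht
    have hind : Integrable ((bad t).indicator (1 : Ω → ℝ)) Pr :=
      (integrable_const (1 : ℝ)).indicator (hbad t)
    rw [← integral_finsetSum _ fun a _ => hi t a, ← integral_indicator_one (hbad t),
      ← integral_add hind (integrable_finsetSum _ fun a _ => hi t a)]
    refine integral_mono (h.integrable_gap hB t)
      (hind.add (integrable_finsetSum _ fun a _ => hi t a)) fun ω => ?_
    have hnn : 0 ≤ ∑ a, f (pulls A a t ω) * p (t + 1) ω a :=
      Finset.sum_nonneg fun a _ => mul_nonneg (hf _) ((hB.simplex (h.mem t ω)).1 a)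
    by_cases hω : ω ∈ bad t
    · have := hB.gap_le_one' (h.mem t ω)
      simp only [Set.indicator_of_mem hω, Pi.one_apply]
      linarith
    · simp only [Set.indicator_of_notMem hω, zero_add]
      exact hgap t (Finset.mem_range.1 ht) ω hω
  rw [h.regret_eq_sum hB]
  refine (Finset.sum_le_sum hstep).trans ?_
  rw [Finset.sum_add_distrib, Finset.sum_comm]
  gcongr
  calc _ ≤ ∑ _ : Fin K, B := Finset.sum_le_sum fun a _ =>
        h.sum_integral_comp_pulls_mul_le hB hf hfB a
    _ = K * B := by simp

/-! ### The gap on the good event -/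

/-- The exploration bonus after `t` rounds of an arm drawn `n` times. -/
noncomputable def bonus (t n : ℕ) : ℝ := Real.sqrt (2 * Real.log t / (max n 1 : ℕ))

lemma bonus_nonneg (t n : ℕ) : 0 ≤ bonus t n := Real.sqrt_nonneg _

lemma bonus_sq {t : ℕ} (ht : 1 ≤ t) (n : ℕ) :
    bonus t n ^ 2 = 2 * Real.log t / (max n 1 : ℕ) :=
  Real.sq_sqrt (div_nonneg (mul_nonneg two_pos.le (Real.log_nonneg (by exact_mod_cast ht)))
    (Nat.cast_nonneg _))

lemma sqrt_mul_eq_mul_bonus (t : ℕ) {n : ℕ} (hn : 1 ≤ n) :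
    Real.sqrt (2 * Real.log t * n) = n * bonus t n := by
  have hn0 : (0 : ℝ) < n := by exact_mod_cast hn
  rw [bonus, max_eq_left hn, ← Real.sqrt_sq hn0.le, ← Real.sqrt_mul (sq_nonneg _),
    Real.sqrt_sq hn0.le]
  congr 1
  field_simp

lemma ucb_of_pulls_pos {a : Fin K} {t : ℕ} (ht : 1 ≤ t) {ω : Ω} (hN : 1 ≤ pulls A a t ω) :
    ucb A Y t ω a = means ν a + noise ν A Y a t ω / pulls A a t ω +
      bonus t (pulls A a t ω) := by
  have hN0 : (pulls A a t ω : ℝ) ≠ 0 := by exact_mod_cast (by omega : pulls A a t ω ≠ 0)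
  rw [ucb, if_neg (by omega), empMean, if_neg (by omega), sum_reward_eq (ν := ν), bonus]
  congr 1
  field_simp
  ring

lemma ucb_of_pulls_zero {a : Fin K} {t : ℕ} (ht : 1 ≤ t) {ω : Ω} (hN : pulls A a t ω = 0) :
    ucb A Y t ω a = 1 + bonus t (pulls A a t ω) := by
  rw [ucb, if_neg (by omega), empMean, if_pos hN, bonus]

/-- An arm never drawn is not covered by `deviation`, but its index is at least 1 and so dominates
its mean. -/
lemma means_le_ucb {a : Fin K} {t : ℕ} (ht : 1 ≤ t) {ω : Ω} (hμ : means ν a ≤ 1)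
    (hω : ω ∉ deviation ν A Y (-1) 1 a t) : means ν a ≤ ucb A Y t ω a := by
  rcases Nat.eq_zero_or_pos (pulls A a t ω) with hN | hN
  · rw [ucb_of_pulls_zero ht hN]
    linarith [bonus_nonneg t (pulls A a t ω)]
  · have hN0 : (0 : ℝ) < pulls A a t ω := by exact_mod_cast hN
    rw [ucb_of_pulls_pos (ν := ν) ht hN]
    have h1 : -1 * noise ν A Y a t ω < 1 * Real.sqrt (2 * Real.log t * pulls A a t ω) := by
      by_contra! hc
      exact hω ⟨hN, hc⟩
    rw [sqrt_mul_eq_mul_bonus t hN] at h1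
    have : -bonus t (pulls A a t ω) ≤ noise ν A Y a t ω / pulls A a t ω := by
      rw [le_div_iff₀ hN0]; linarith
    linarith

/-- The free constant `c` allows a tighter upper tail than the bonus itself; the bound for diverse
actions takes `c < 1`. -/
lemma ucb_sub_means_le {a : Fin K} {t : ℕ} (ht : 1 ≤ t) {ω : Ω} {c : ℝ}
    (hN : 1 ≤ pulls A a t ω) (hω : ω ∉ deviation ν A Y 1 c a t) :
    ucb A Y t ω a - means ν a ≤ (1 + c) * bonus t (pulls A a t ω) := by
  have hN0 : (0 : ℝ) < pulls A a t ω := by exact_mod_cast hN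
  rw [ucb_of_pulls_pos (ν := ν) ht hN]
  have h1 : 1 * noise ν A Y a t ω < c * Real.sqrt (2 * Real.log t * pulls A a t ω) := by
    by_contra! hc
    exact hω ⟨hN, hc⟩
  rw [sqrt_mul_eq_mul_bonus t hN] at h1
  have : noise ν A Y a t ω / pulls A a t ω ≤ c * bonus t (pulls A a t ω) := by
    rw [div_le_iff₀ hN0]; linarith
  linarith

lemma ucb_sub_means_le_two_mul {a : Fin K} {t : ℕ} (ht : 2 ≤ t) {ω : Ω} (hμ : 0 ≤ means ν a)
    (hω : ω ∉ deviation ν A Y 1 1 a t) :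
    ucb A Y t ω a - means ν a ≤ 2 * bonus t (pulls A a t ω) := by
  rcases Nat.eq_zero_or_pos (pulls A a t ω) with hN | hN
  · rw [ucb_of_pulls_zero (by omega) hN]
    -- For an arm never drawn the excess is at most `1 + bonus`, and `2 ln 2 ≥ 1` makes the bonus at
    -- least 1. This needs `t ≥ 2`, since the bonus vanishes at `t = 1`.
    have : 1 ≤ bonus t (pulls A a t ω) := by
      rw [bonus, Real.one_le_sqrt, hN]
      have := Real.log_le_log two_pos (by exact_mod_cast ht : (2 : ℝ) ≤ t)
      norm_num
      linarith [Real.log_two_gt_d9]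
    linarith
  · linarith [ucb_sub_means_le (by omega) hN hω]

/-- Optimism: `⟨e, μ⟩ ≤ ⟨e, U⟩ ≤ ⟨p, U⟩`, by the lower tails and then by the choice of `p`; only the
excess of `U` over `μ` along `p` remains. -/
lemma IsDivUCB.gap_le (h : IsDivUCB P E ν Pr ℱ p A Y) (hB : IsBanditModel P E ν e Δ) {t : ℕ}
    (ht : 1 ≤ t) {ω : Ω} (hlow : ∀ a, ω ∉ deviation ν A Y (-1) 1 a t) {b : Fin K → ℝ}
    (hup : ∀ a, ucb A Y t ω a - means ν a ≤ b a) :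
    gap P (means ν) (p (t + 1) ω) ≤ ∑ a, b a * p (t + 1) ω a := by
  have hμ := means_mem_Icc hB.prob hB.supp
  have h1 := payoff_mono (hB.simplex (hB.sub e hB.opt_mem)).1
    fun a => means_le_ucb ht (hμ a).2 (hlow a)
  have h2 := h.argmax t ω e hB.opt_mem
  have h3 : payoff (p (t + 1) ω) (ucb A Y t ω) - payoff (p (t + 1) ω) (means ν) ≤
      ∑ a, b a * p (t + 1) ω a := by
    rw [payoff, payoff, ← Finset.sum_sub_distrib]
    refine Finset.sum_le_sum fun a _ => ?_
    rw [← mul_sub, mul_comm]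
    exact mul_le_mul_of_nonneg_right (hup a) ((hB.simplex (h.mem t ω)).1 a)
  rw [gap, hB.opt_eq]
  linarith

end Regret


/-! ### Elementary sums -/

lemma sum_Ico_two_rpow_neg_le {s : ℝ} (hs : 1 < s) (T : ℕ) :
    ∑ t ∈ Finset.Ico 2 T, (t : ℝ) ^ (-s) ≤ 1 / (s - 1) := by
  rcases Nat.lt_or_ge T 3 with hT | hT
  · rw [Finset.Ico_eq_empty_of_le (by omega)]
    simpa using hs.le
  obtain ⟨n, rfl⟩ : ∃ n, T = n + 1 := ⟨T - 1, by omega⟩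
  have hanti : AntitoneOn (fun x : ℝ => x ^ (-s)) (Set.Icc ((1 : ℕ) : ℝ) (n : ℕ)) := by
    intro x hx y hy hxy
    have hx0 : (0 : ℝ) < x := lt_of_lt_of_le (by simp) hx.1
    exact Real.rpow_le_rpow_of_nonpos hx0 hxy (by linarith)
  have h := hanti.sum_le_integral_Ico (by omega : 1 ≤ n)
  have hshift : ∑ t ∈ Finset.Ico 2 (n + 1), (t : ℝ) ^ (-s) =
      ∑ i ∈ Finset.Ico 1 n, ((i + 1 : ℕ) : ℝ) ^ (-s) :=
    (Finset.sum_Ico_add' (fun t : ℕ => (t : ℝ) ^ (-s)) 1 n 1).symm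
  rw [hshift]
  refine h.trans ?_
  have hn1 : (1 : ℝ) ≤ n := by exact_mod_cast (by omega : 1 ≤ n)
  rw [integral_rpow (Or.inr ⟨by linarith, by
    rw [Nat.cast_one, Set.uIcc_of_le hn1]
    exact fun h0 => by linarith [h0.1]⟩)]
  rw [Nat.cast_one, Real.one_rpow, show -s + 1 = -(s - 1) by ring, div_neg, ← neg_div, neg_sub]
  have : 0 ≤ (n : ℝ) ^ (-(s - 1)) := by positivity
  exact div_le_div_of_nonneg_right (by linarith) (by linarith)

lemma sum_Ico_two_exp_neg_mul_le {y : ℝ} (hy : 0 < y) (T : ℕ) :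
    ∑ t ∈ Finset.Ico 2 T, Real.exp (-(t * y)) ≤ 1 / y := by
  have key : ∀ n : ℕ, ∑ t ∈ Finset.range n, Real.exp (-((t + 1 : ℕ) * y)) ≤
      (1 - Real.exp (-(n * y))) / y := by
    intro n
    induction n with
    | zero => simp
    | succ n ih =>
      rw [Finset.sum_range_succ]
      have e1 : Real.exp (-(n * y)) = Real.exp (-((n + 1 : ℕ) * y)) * Real.exp y := by
        rw [← Real.exp_add]; push_cast; ring_nf
      -- From `1 + y ≤ exp y`, each term is at most the decrement of `exp (-n y) / y`, and these
      -- telescope.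
      have e2 : Real.exp (-((n + 1 : ℕ) * y)) * (y + 1) ≤ Real.exp (-(n * y)) := by
        rw [e1]
        exact mul_le_mul_of_nonneg_left (Real.add_one_le_exp y) (Real.exp_nonneg _)
      rw [le_div_iff₀ hy] at ih ⊢
      linarith
  calc ∑ t ∈ Finset.Ico 2 T, Real.exp (-(t * y))
      ≤ ∑ t ∈ Finset.Ico 1 (T + 1), Real.exp (-(t * y)) :=
        Finset.sum_le_sum_of_subset_of_nonneg
          (Finset.Ico_subset_Ico (by omega) (by omega)) fun _ _ _ => (Real.exp_nonneg _)
    _ = ∑ t ∈ Finset.range T, Real.exp (-((t + 1 : ℕ) * y)) := by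
        rw [← Finset.sum_Ico_add' (fun t : ℕ => Real.exp (-(t * y))) 0 T 1, Finset.range_eq_Ico]
    _ ≤ (1 - Real.exp (-(T * y))) / y := key T
    _ ≤ 1 / y := div_le_div_of_nonneg_right (by linarith [Real.exp_nonneg (-(T * y))]) hy.le

lemma sum_range_le_two_add {u v : ℕ → ℝ} (hu : ∀ t, u t ≤ 1)
    (huv : ∀ t, 2 ≤ t → u t ≤ v t) (T : ℕ) :
    ∑ t ∈ Finset.range T, u t ≤ 2 + ∑ t ∈ Finset.Ico 2 T, v t := by
  rcases Nat.lt_or_ge T 2 with hT | hT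
  · rw [Finset.Ico_eq_empty_of_le hT.le]
    interval_cases T
    · simp
    · simpa using (hu 0).trans one_le_two
  · rw [Finset.range_eq_Ico, ← Finset.sum_Ico_consecutive u (Nat.zero_le 2) hT]
    refine add_le_add ?_ (Finset.sum_le_sum fun t ht => huv t (Finset.mem_Ico.1 ht).1)
    rw [← Finset.range_eq_Ico, Finset.sum_range_succ, Finset.sum_range_one]
    linarith [hu 0, hu 1]

lemma sum_range_inv_max_one_le {N T : ℕ} (hN : N ≤ T) :
    ∑ n ∈ Finset.range N, (1 : ℝ) / (max n 1 : ℕ) ≤ 2 + Real.log T := by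
  have hlog := Real.log_natCast_nonneg T
  rcases Nat.eq_zero_or_pos N with rfl | hpos
  · simp; linarith
  obtain ⟨m, rfl⟩ : ∃ m, N = m + 1 := ⟨N - 1, by omega⟩
  rw [Finset.sum_range_succ']
  have h1 : ∑ n ∈ Finset.range m, (1 : ℝ) / (max (n + 1) 1 : ℕ) = (harmonic m : ℝ) := by
    rw [harmonic]
    push_cast
    refine Finset.sum_congr rfl fun n _ => ?_
    rw [max_eq_left (by linarith [(Nat.cast_nonneg n : (0 : ℝ) ≤ n)]), one_div]
  have h2 := harmonic_le_one_add_log m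
  have h3 : Real.log m ≤ Real.log T := by
    rcases Nat.eq_zero_or_pos m with rfl | hm
    · simpa using hlog
    · exact Real.log_le_log (by exact_mod_cast hm) (by exact_mod_cast (by omega : m ≤ T))
  rw [h1]
  simp
  linarith

/-! ### The squared-logarithm bound, valid for all problems. -/

section UniversalBound

variable {Ω : Type*} {mΩ : MeasurableSpace Ω} {K : ℕ} {P : Set (Fin K → ℝ)}
  {ν : Fin K → Measure ℝ} {Pr : Measure Ω} {ℱ : Filtration ℕ mΩ}
  {p : ℕ → Ω → Fin K → ℝ} {A : ℕ → Ω → Fin K} {Y : ℕ → Ω → ℝ}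
  {E : Finset (Fin K → ℝ)} {e : Fin K → ℝ} {Δ : ℝ}

/-- The event that the average reward of some arm after `t` rounds is far from its mean. -/
def failure (ν : Fin K → Measure ℝ) (A : ℕ → Ω → Fin K) (Y : ℕ → Ω → ℝ) (c : ℝ) (t : ℕ) :
    Set Ω :=
  ⋃ a, (deviation ν A Y (-1) 1 a t ∪ deviation ν A Y 1 c a t)

lemma IsProtocol.measurableSet_failure (h : IsProtocol P ν Pr ℱ p A Y) (c : ℝ) (t : ℕ) :
    MeasurableSet (failure ν A Y c t) :=
  MeasurableSet.iUnion fun a =>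
    (h.measurableSet_deviation (-1) 1 a t).union (h.measurableSet_deviation 1 c a t)

lemma measureReal_iUnion_fin_le [IsProbabilityMeasure Pr] {S : Fin K → Set Ω} {B : ℝ}
    (hS : ∀ a, Pr.real (S a) ≤ B) : Pr.real (⋃ a, S a) ≤ K * B :=
  calc Pr.real (⋃ a, S a) ≤ ∑ a, Pr.real (S a) := measureReal_iUnion_fintype_le _
    _ ≤ ∑ _ : Fin K, B := Finset.sum_le_sum fun a _ => hS a
    _ = K * B := by simp

lemma IsProtocol.measureReal_failure_le (h : IsProtocol P ν Pr ℱ p A Y)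
    [IsProbabilityMeasure Pr] (hB : IsBanditModel P E ν e Δ) {c : ℝ} (hc : 0 ≤ c) {t : ℕ}
    (ht : 1 ≤ t) :
    Pr.real (failure ν A Y c t) ≤ K * ((t : ℝ) ^ (-3 : ℝ) + (t : ℝ) ^ (-(4 * c ^ 2 - 1))) := by
  refine measureReal_iUnion_fin_le fun a => (measureReal_union_le _ _).trans (add_le_add ?_ ?_)
  · refine (h.measureReal_deviation_le hB.simplex hB.prob hB.supp (by norm_num) zero_le_one a
      ht).trans (le_of_eq ?_)
    norm_num
  · refine (h.measureReal_deviation_le hB.simplex hB.prob hB.supp (by norm_num) hc a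
      ht).trans (le_of_eq ?_)
    congr 1
    ring

lemma notMem_failure {c : ℝ} {t : ℕ} {ω : Ω} (hω : ω ∉ failure ν A Y c t) (a : Fin K) :
    ω ∉ deviation ν A Y (-1) 1 a t ∧ ω ∉ deviation ν A Y 1 c a t := by
  simp only [failure, Set.mem_iUnion, Set.mem_union, not_exists, not_or] at hω
  exact hω a

lemma IsProtocol.regret_le_two_add (h : IsProtocol P ν Pr ℱ p A Y) [IsProbabilityMeasure Pr]
    (hB : IsBanditModel P E ν e Δ) {f : ℕ → ℝ} (hf : ∀ n, 0 ≤ f n) {T : ℕ} {B : ℝ}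
    (hfB : ∀ N ≤ T, ∑ n ∈ Finset.range N, f n ≤ B) {bad : ℕ → Set Ω}
    (hbad : ∀ t, MeasurableSet (bad t)) {v : ℕ → ℝ} (hv : ∀ t, 2 ≤ t → Pr.real (bad t) ≤ v t)
    (hgap : ∀ t, 2 ≤ t → t < T → ∀ ω ∉ bad t,
      gap P (means ν) (p (t + 1) ω) ≤ ∑ a, f (pulls A a t ω) * p (t + 1) ω a) :
    regret P ν Pr p T ≤ 2 + ∑ t ∈ Finset.Ico 2 T, v t + K * B := by
  -- Times 0 and 1 are declared bad throughout, which accounts for the additive 2.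
  set bad' : ℕ → Set Ω := fun t => if 2 ≤ t then bad t else Set.univ with hbad'
  refine (h.regret_le hB hf hfB (bad := bad') (fun t => ?_) fun t htT ω hω => ?_).trans
    (add_le_add_left (sum_range_le_two_add (fun t => measureReal_le_one)
      (fun t ht => ?_) T) _)
  · by_cases ht : 2 ≤ t
    · simpa only [hbad', ht, if_true] using hbad t
    · simp only [hbad', ht, if_false, MeasurableSet.univ]
  · by_cases ht : 2 ≤ t
    · simp only [hbad', ht, if_true] at hω
      exact hgap t ht htT ω hω
    · simp only [hbad', ht, if_false, Set.mem_univ, not_true] at hω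
  · simpa only [hbad', ht, if_true] using hv t ht

lemma IsDivUCB.gap_le_two_mul_bonus (h : IsDivUCB P E ν Pr ℱ p A Y)
    (hB : IsBanditModel P E ν e Δ) {t : ℕ} (ht : 2 ≤ t) {ω : Ω}
    (hω : ω ∉ failure ν A Y 1 t) :
    gap P (means ν) (p (t + 1) ω) ≤ ∑ a, 2 * bonus t (pulls A a t ω) * p (t + 1) ω a :=
  h.gap_le hB (by omega) (fun a => (notMem_failure hω a).1) fun a =>
    ucb_sub_means_le_two_mul ht (means_mem_Icc hB.prob hB.supp a).1 (notMem_failure hω a).2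

/-- On the good event, the gap is controlled by the mean of the inverse counts. -/
lemma IsDivUCB.gap_le_log_div (h : IsDivUCB P E ν Pr ℱ p A Y)
    (hB : IsBanditModel P E ν e Δ) {t : ℕ} (ht : 2 ≤ t) {T : ℝ} (htT : t ≤ T) {ω : Ω}
    (hω : ω ∉ failure ν A Y 1 t) :
    gap P (means ν) (p (t + 1) ω) ≤
      ∑ a, 8 * Real.log T / Δ * (1 / (max (pulls A a t ω) 1 : ℕ)) * p (t + 1) ω a := by
  have hs := hB.simplex (h.mem t ω)
  have hΔ := hB.gap_pos
  have hlog : Real.log t ≤ Real.log T :=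
    Real.log_le_log (by exact_mod_cast (by omega : 0 < t)) htT
  have hlog0 := Real.log_natCast_nonneg t
  set G := gap P (means ν) (p (t + 1) ω) with hG
  have hG0 : 0 ≤ G := hB.gap_nonneg (h.mem t ω)
  have h1 := h.gap_le_two_mul_bonus hB ht hω
  have h2 : (∑ a, p (t + 1) ω a * (2 * bonus t (pulls A a t ω))) ^ 2 ≤
      ∑ a, p (t + 1) ω a * (2 * bonus t (pulls A a t ω)) ^ 2 :=
    Real.pow_arith_mean_le_arith_mean_pow _ _ _ (fun a _ => hs.1 a) hs.2
      (fun a _ => mul_nonneg two_pos.le (bonus_nonneg _ _)) 2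
  have h3 : G ^ 2 ≤ ∑ a, p (t + 1) ω a * (2 * bonus t (pulls A a t ω)) ^ 2 := by
    refine (pow_le_pow_left₀ hG0 (h1.trans (le_of_eq ?_)) 2).trans h2
    exact Finset.sum_congr rfl fun a _ => mul_comm _ _
  -- Self-bounding: `G` is either 0 or at least `Δ`, because the action belongs to `E`.
  have h4 : G ≤ G ^ 2 / Δ := by
    rcases hG0.eq_or_lt with h0 | h0
    · rw [← h0]; simp
    · rw [le_div_iff₀ hΔ, sq]
      exact mul_le_mul_of_nonneg_left (hB.gap_le _ (h.argmax_mem t ω) h0) hG0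
  refine h4.trans ?_
  rw [div_le_iff₀ hΔ, Finset.sum_mul]
  refine h3.trans (Finset.sum_le_sum fun a _ => ?_)
  have hm : (0 : ℝ) < (max (pulls A a t ω) 1 : ℕ) := by
    exact_mod_cast lt_of_lt_of_le one_pos (le_max_right _ _)
  rw [mul_pow, bonus_sq (by omega)]
  have e1 : p (t + 1) ω a * (2 ^ 2 * (2 * Real.log t / (max (pulls A a t ω) 1 : ℕ))) =
      8 * (p (t + 1) ω a / (max (pulls A a t ω) 1 : ℕ)) * Real.log t := by ring
  have e2 : 8 * Real.log T / Δ * (1 / (max (pulls A a t ω) 1 : ℕ)) * p (t + 1) ω a * Δ =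
      8 * (p (t + 1) ω a / (max (pulls A a t ω) 1 : ℕ)) * Real.log T := by
    field_simp
  rw [e1, e2]
  exact mul_le_mul_of_nonneg_left hlog
    (mul_nonneg (by norm_num) (div_nonneg (hs.1 a) hm.le))

/-- The bound on the regret that holds for all bandit problems. -/
theorem IsDivUCB.regret_le_log_sq (h : IsDivUCB P E ν Pr ℱ p A Y) [IsProbabilityMeasure Pr]
    (hB : IsBanditModel P E ν e Δ) (T : ℕ) :
    regret P ν Pr p T ≤ (24 * K * (Real.log (1 + T)) ^ 2 + K + 2) / Δ := by
  have hΔ := hB.gap_pos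
  have hlog := Real.log_natCast_nonneg T
  have hreg := h.regret_le_two_add hB
    (f := fun n => 8 * Real.log T / Δ * (1 / (max n 1 : ℕ))) (fun n => by positivity)
    (T := T) (B := 8 * Real.log T / Δ * (2 + Real.log T))
    (fun N hN => by
      rw [← Finset.mul_sum]
      exact mul_le_mul_of_nonneg_left (sum_range_inv_max_one_le hN) (by positivity))
    (bad := failure ν A Y 1) (h.measurableSet_failure 1)
    (v := fun t => K * ((t : ℝ) ^ (-3 : ℝ) + (t : ℝ) ^ (-3 : ℝ)))
    (fun t ht => by
      refine (h.measureReal_failure_le hB (zero_le_one) (t := t) (by omega)).trans (le_of_eq ?_)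
      norm_num)
    (fun t ht htT ω hω => h.gap_le_log_div hB ht (by exact_mod_cast htT.le) hω)
  have hcube := sum_Ico_two_rpow_neg_le (s := 3) (by norm_num) T
  rw [← Finset.mul_sum, Finset.sum_add_distrib] at hreg
  have hK : (0 : ℝ) ≤ K := Nat.cast_nonneg K
  have hbadsum : K * (∑ t ∈ Finset.Ico 2 T, (t : ℝ) ^ (-3 : ℝ) +
      ∑ t ∈ Finset.Ico 2 T, (t : ℝ) ^ (-3 : ℝ)) ≤ K := by
    have := mul_le_mul_of_nonneg_left (add_le_add hcube hcube) hK
    norm_num at this ⊢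
    linarith
  -- For `T ≥ 2`, `ln (1 + T) ≥ 1` gives `2 + ln T ≤ 3 ln (1 + T)`, whence 24. For `T < 2` the left
  -- side is 0, as `Real.log 0 = 0`.
  have hlogs : 8 * Real.log T * (2 + Real.log T) ≤ 24 * Real.log (1 + T) ^ 2 := by
    rcases Nat.lt_or_ge T 2 with hT | hT
    · have : Real.log T = 0 := by interval_cases T <;> simp
      rw [this, mul_zero, zero_mul]; positivity
    · have hT' : (2 : ℝ) ≤ T := by exact_mod_cast hT
      have h1 : Real.log T ≤ Real.log (1 + T) := Real.log_le_log (by linarith) (by linarith)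
      have h2 : 1 ≤ Real.log (1 + T) := by
        rw [Real.le_log_iff_exp_le (by linarith)]
        linarith [Real.exp_one_lt_d9]
      nlinarith
  have hfin : (2 + K : ℝ) + K * (8 * Real.log T / Δ * (2 + Real.log T)) ≤
      (24 * K * (Real.log (1 + T)) ^ 2 + K + 2) / Δ := by
    rw [le_div_iff₀ hΔ, add_mul]
    have e1 : K * (8 * Real.log T / Δ * (2 + Real.log T)) * Δ =
        K * (8 * Real.log T * (2 + Real.log T)) := by field_simp
    rw [e1]
    have := mul_le_mul_of_nonneg_left hlogs hK
    have := mul_le_mul_of_nonneg_left hB.gap_le_one (by positivity : (0 : ℝ) ≤ 2 + K)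
    linarith
  linarith

end UniversalBound


/-! ### Elementary inequalities -/

/-- The positive parts of `C / √n - Δ` sum up to at most `C ^ 2 / Δ`. -/
lemma sum_range_posPart_le {C Δ : ℝ} (hC : 0 ≤ C) (hΔ : 0 < Δ) (N : ℕ) :
    ∑ n ∈ Finset.range N, max (C / Real.sqrt (n + 1 : ℕ) - Δ) 0 ≤ C ^ 2 / Δ := by
  -- The stronger bound is the integral of the positive part of `C / √x - Δ` over `[0, N]`, in the
  -- form that induction requires.
  suffices h : ∑ n ∈ Finset.range N, max (C / Real.sqrt (n + 1 : ℕ) - Δ) 0 ≤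
      C ^ 2 / Δ - Δ * (max (C / Δ - Real.sqrt N) 0) ^ 2 from
    h.trans (sub_le_self _ (by positivity))
  induction N with
  | zero =>
    have : 0 ≤ C / Δ := by positivity
    simp only [Finset.range_zero, Finset.sum_empty, Nat.cast_zero, Real.sqrt_zero, sub_zero,
      max_eq_left this]
    apply le_of_eq
    field_simp
    ring
  | succ N ih =>
    rw [Finset.sum_range_succ]
    set r := Real.sqrt N with hr
    set s := Real.sqrt ((N + 1 : ℕ) : ℝ) with hs
    have hr0 : 0 ≤ r := Real.sqrt_nonneg _
    have hs0 : 0 < s := Real.sqrt_pos.2 (by positivity)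
    have hr2 : r ^ 2 = N := Real.sq_sqrt (by positivity)
    have hs2 : s ^ 2 = N + 1 := by rw [hs, Real.sq_sqrt (by positivity)]; push_cast; ring
    have hrs : r ≤ s := Real.sqrt_le_sqrt (by push_cast; linarith)
    rcases le_total s (C / Δ) with h | h
    · have hC' : s * Δ ≤ C := (le_div_iff₀ hΔ).1 h
      have h1 : 0 ≤ C / s - Δ := by rw [sub_nonneg, le_div_iff₀ hs0]; linarith
      rw [max_eq_left h1, max_eq_left (sub_nonneg.2 h)]
      rw [max_eq_left (sub_nonneg.2 (hrs.trans h))] at ih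
      have e1 : Δ * (C / Δ - r) ^ 2 = C ^ 2 / Δ - 2 * C * r + Δ * r ^ 2 := by field_simp; ring
      have e2 : Δ * (C / Δ - s) ^ 2 = C ^ 2 / Δ - 2 * C * s + Δ * s ^ 2 := by field_simp; ring
      rw [e1, hr2] at ih
      rw [e2, hs2]
      have h2 : C / s ≤ 2 * C * s - 2 * C * r := by
        rw [div_le_iff₀ hs0]
        -- As `s² - r² = 1`, the right side equals `1 + (s - r)²`.
        have : 1 ≤ (2 * s - 2 * r) * s := by nlinarith [sq_nonneg (s - r)]
        nlinarith
      linarith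
    · have hC' : C ≤ s * Δ := (div_le_iff₀ hΔ).1 h
      have h1 : C / s - Δ ≤ 0 := by rw [sub_nonpos, div_le_iff₀ hs0]; linarith
      rw [max_eq_right h1, max_eq_right (sub_nonpos.2 h), add_zero]
      refine ih.trans ?_
      have : 0 ≤ Δ * max (C / Δ - r) 0 ^ 2 := by positivity
      simp only [ne_eq, OfNat.ofNat_ne_zero, not_false_eq_true, zero_pow, mul_zero, sub_zero]
      linarith

/-- With `u = t / x`, the hypothesis reads `u ≤ ln x + ln u`, and `ln u < u / 2` because `ln 2 < 1`.
-/
lemma lt_of_le_mul_log {x t : ℝ} (hx : 0 < x) (ht : 0 < t) (h : t ≤ x * Real.log t) :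
    t < 2 * x * Real.log x := by
  have hu : 0 < t / x := div_pos ht hx
  have h1 : t / x ≤ Real.log x + Real.log (t / x) := by
    rw [← Real.log_mul hx.ne' hu.ne', mul_div_cancel₀ t hx.ne', div_le_iff₀ hx]
    linarith
  have h2 : Real.log (t / x) < t / x / 2 := by
    have h3 := Real.log_le_sub_one_of_pos (half_pos hu)
    rw [Real.log_div hu.ne' two_ne_zero] at h3
    linarith [Real.log_two_lt_d9]
  have h4 : t / x < 2 * Real.log x := by linarith
  rw [div_lt_iff₀ hx] at h4
  linarith

/-! ### The closed-form bound when every mixed action is diverse. -/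

section DiverseBound

variable {Ω : Type*} {mΩ : MeasurableSpace Ω} {K : ℕ} {P : Set (Fin K → ℝ)}
  {ν : Fin K → Measure ℝ} {Pr : Measure Ω} {ℱ : Filtration ℕ mΩ}
  {p : ℕ → Ω → Fin K → ℝ} {A : ℕ → Ω → Fin K} {Y : ℕ → Ω → ℝ}
  {E : Finset (Fin K → ℝ)} {e : Fin K → ℝ} {Δ : ℝ}

lemma drift_one (a : Fin K) (t : ℕ) (ω : Ω) :
    drift p A a (fun _ _ => 1) t ω =
      ∑ s ∈ Finset.range t, p (s + 1) ω a - pulls A a t ω := by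
  have := sum_ite_mul_pulls (A := A) a (fun _ => 1) t ω
  simp only [one_mul, Finset.sum_const, Finset.card_range, nsmul_eq_mul, mul_one] at this
  simp only [drift, one_mul, Finset.sum_sub_distrib, this]

lemma bonus_le_sqrt {t n : ℕ} (hn : 1 ≤ n) {L : ℝ} (hL : Real.log t ≤ L) :
    bonus t n ≤ Real.sqrt (2 * L) / Real.sqrt n := by
  rw [bonus, max_eq_left hn, ← Real.sqrt_div' _ (Nat.cast_nonneg n)]
  exact Real.sqrt_le_sqrt (div_le_div_of_nonneg_right (by linarith) (Nat.cast_nonneg n))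

/-- The event that some average reward is far from its mean, or that some arm was drawn less than
half as often as guaranteed in expectation. -/
def diverseFailure (ν : Fin K → Measure ℝ) (p : ℕ → Ω → Fin K → ℝ) (A : ℕ → Ω → Fin K)
    (Y : ℕ → Ω → ℝ) (c q : ℝ) (t : ℕ) : Set Ω :=
  failure ν A Y c t ∪ ⋃ a, {ω | q * t / 2 ≤ drift p A a (fun _ _ => 1) t ω}

lemma IsProtocol.measurableSet_diverseFailure (h : IsProtocol P ν Pr ℱ p A Y) (c q : ℝ)
    (t : ℕ) : MeasurableSet (diverseFailure ν p A Y c q t) :=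
  (h.measurableSet_failure c t).union (MeasurableSet.iUnion fun a =>
    measurableSet_le measurable_const
      ((h.measurable_drift a (fun _ => measurable_const) t).mono (ℱ.le t) le_rfl))

lemma IsProtocol.measureReal_diverseFailure_le (h : IsProtocol P ν Pr ℱ p A Y)
    [IsProbabilityMeasure Pr] (hB : IsBanditModel P E ν e Δ) {c q : ℝ} (hc : 0 ≤ c)
    (hq : 0 ≤ q) {t : ℕ} (ht : 1 ≤ t) :
    Pr.real (diverseFailure ν p A Y c q t) ≤
      K * ((t : ℝ) ^ (-3 : ℝ) + (t : ℝ) ^ (-(4 * c ^ 2 - 1)) +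
        Real.exp (-(t * (q ^ 2 / 2)))) := by
  rw [mul_add]
  refine (measureReal_union_le _ _).trans (add_le_add (h.measureReal_failure_le hB hc ht) ?_)
  refine measureReal_iUnion_fin_le fun a => ?_
  refine (h.measureReal_drift_ge_le hB.simplex hB.prob a (fun _ => measurable_const)
    (fun _ _ => by simp) ht (u := q * t / 2) (by positivity)).trans (le_of_eq ?_)
  have ht0 : (t : ℝ) ≠ 0 := by exact_mod_cast (by omega : t ≠ 0)
  congr 1
  field_simp

lemma le_pulls_of_notMem_diverseFailure {c q : ℝ} {t : ℕ} {ω : Ω}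
    (hω : ω ∉ diverseFailure ν p A Y c q t) (hq : ∀ s a, q ≤ p (s + 1) ω a) (a : Fin K) :
    q * t / 2 ≤ pulls A a t ω := by
  simp only [diverseFailure, Set.mem_union, Set.mem_iUnion, not_or, not_exists] at hω
  have h1 : drift p A a (fun _ _ => 1) t ω < q * t / 2 := not_le.1 (hω.2 a)
  rw [drift_one] at h1
  have h2 := Finset.card_nsmul_le_sum (Finset.range t) (fun s => p (s + 1) ω a) q
    fun s _ => hq s a
  rw [Finset.card_range, nsmul_eq_mul] at h2
  linarith

/-- Linear counts make suboptimal play impossible once `ln t` exceeds `L`, so `L` replaces the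
logarithm of the horizon. Every arm has been drawn here, so the value 0 given to the summand at
count 0 is harmless. -/
lemma IsDivUCB.gap_le_of_notMem_diverseFailure (h : IsDivUCB P E ν Pr ℱ p A Y)
    (hB : IsBanditModel P E ν e Δ) {c q : ℝ} (hc : 0 ≤ c) (hc1 : c ≤ 1) (hq0 : 0 < q)
    (hq : ∀ p ∈ P, ∀ a, q ≤ p a) {t : ℕ} (ht : 2 ≤ t) {ω : Ω}
    (hω : ω ∉ diverseFailure ν p A Y c q t) {L C : ℝ}
    (hL : L = Real.log (1 + 32 / (Δ ^ 2 * q) * Real.log (16 / (Δ ^ 2 * q))))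
    (hC : C = 2 * (1 + c) * Real.sqrt (2 * L)) :
    gap P (means ν) (p (t + 1) ω) ≤
      ∑ a, (if pulls A a t ω = 0 then 0
        else max (C / Real.sqrt (pulls A a t ω) - Δ) 0) * p (t + 1) ω a := by
  have hs := hB.simplex (h.mem t ω)
  have hΔ := hB.gap_pos
  have ht0 : (0 : ℝ) < t := by exact_mod_cast (by omega : 0 < t)
  have hlog0 := Real.log_natCast_nonneg t
  have hpull := le_pulls_of_notMem_diverseFailure hω fun s a => hq _ (h.mem s ω) a
  have hpull0 : ∀ a, (0 : ℝ) < pulls A a t ω := fun a => lt_of_lt_of_le (by positivity) (hpull a)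
  have hpull1 : ∀ a, 1 ≤ pulls A a t ω := fun a => by exact_mod_cast hpull0 a
  have hω1 : ω ∉ failure ν A Y c t := fun hmem => hω (Or.inl hmem)
  have hgap := h.gap_le hB (by omega) (fun a => (notMem_failure hω1 a).1)
    fun a => ucb_sub_means_le (by omega) (hpull1 a) (notMem_failure hω1 a).2
  set G := gap P (means ν) (p (t + 1) ω) with hG
  rcases (hB.gap_nonneg (h.mem t ω)).eq_or_lt with h0 | h0
  · rw [hG, ← h0]
    refine Finset.sum_nonneg fun a _ => mul_nonneg ?_ (hs.1 a)
    split_ifs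
    · exact le_rfl
    · exact le_max_right _ _
  have hGΔ : Δ ≤ G := hB.gap_le _ (h.argmax_mem t ω) h0
  have htlog : t ≤ 16 / (Δ ^ 2 * q) * Real.log t := by
    have hb : ∀ a, bonus t (pulls A a t ω) ≤ Real.sqrt (4 * Real.log t / (q * t)) := fun a => by
      rw [bonus, max_eq_left (hpull1 a)]
      refine Real.sqrt_le_sqrt ?_
      rw [show 4 * Real.log t / (q * t) = 2 * Real.log t / (q * t / 2) by field_simp; ring]
      exact div_le_div_of_nonneg_left (by positivity) (by positivity) (hpull a)
    have h1 : G ≤ 2 * Real.sqrt (4 * Real.log t / (q * t)) := by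
      refine hgap.trans ?_
      calc _ ≤ ∑ a, 2 * Real.sqrt (4 * Real.log t / (q * t)) * p (t + 1) ω a := by
            refine Finset.sum_le_sum fun a _ => mul_le_mul_of_nonneg_right ?_ (hs.1 a)
            exact mul_le_mul (by linarith) (hb a) (bonus_nonneg _ _) two_pos.le
        _ = _ := by rw [← Finset.mul_sum, hs.2, mul_one]
    have h2 : Δ ^ 2 ≤ 16 * Real.log t / (q * t) := by
      refine (pow_le_pow_left₀ hΔ.le (hGΔ.trans h1) 2).trans (le_of_eq ?_)
      rw [mul_pow, Real.sq_sqrt (by positivity)]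
      ring
    rw [le_div_iff₀ (by positivity)] at h2
    rw [div_mul_eq_mul_div, le_div_iff₀ (by positivity)]
    linarith
  have htx := lt_of_le_mul_log (x := 16 / (Δ ^ 2 * q)) (by positivity) ht0 htlog
  have htL : Real.log t ≤ L := by
    rw [hL]
    refine Real.log_le_log ht0 ?_
    have : 2 * (16 / (Δ ^ 2 * q)) = 32 / (Δ ^ 2 * q) := by ring
    rw [this] at htx
    linarith
  -- This is `G ≤ 2G - Δ` with the optimism bound inserted for `2G`; `Δ` is spread over the arms as
  -- the weights sum to 1.
  have hGsum : G ≤ ∑ a, (2 * ((1 + c) * bonus t (pulls A a t ω)) - Δ) * p (t + 1) ω a := by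
    simp_rw [sub_mul, mul_assoc (2 : ℝ)]
    rw [Finset.sum_sub_distrib, ← Finset.mul_sum, ← Finset.mul_sum, hs.2]
    linarith
  refine hGsum.trans (Finset.sum_le_sum fun a _ => mul_le_mul_of_nonneg_right ?_ (hs.1 a))
  rw [if_neg (by have := hpull1 a; omega)]
  refine le_max_of_le_left (sub_le_sub_right ?_ _)
  rw [hC, ← mul_assoc, mul_div_assoc]
  exact mul_le_mul_of_nonneg_left (bonus_le_sqrt (hpull1 a) htL) (by positivity)

/-- The bound on the regret when all mixed actions put some mass on all arms. -/
theorem IsDivUCB.regret_le_of_minProb_pos (h : IsDivUCB P E ν Pr ℱ p A Y)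
    [IsProbabilityMeasure Pr] (hB : IsBanditModel P E ν e Δ)
    (hsub : ∃ p ∈ E, 0 < gap P (means ν) p) (hℓ : 0 < minProb P) (T : ℕ) :
    regret P ν Pr p T ≤
      24 * K / Δ * Real.log (1 + 32 / (Δ ^ 2 * minProb P) *
        Real.log (16 / (Δ ^ 2 * minProb P))) + (7 * K + 3) / min Δ (minProb P ^ 2) := by
  have hΔ := hB.gap_pos
  have hℓ2 := hB.two_mul_minProb_le hsub hℓ
  have hΔ1 := hB.gap_le_one
  set q := minProb P with hq
  set L := Real.log (1 + 32 / (Δ ^ 2 * q) * Real.log (16 / (Δ ^ 2 * q))) with hLdef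
  have hL0 : 0 ≤ L := by
    have hle : Δ ^ 2 * q ≤ 1 := mul_le_one₀ (pow_le_one₀ hΔ.le hΔ1) hℓ.le (by linarith)
    have h1 : 0 ≤ Real.log (16 / (Δ ^ 2 * q)) :=
      Real.log_nonneg (by rw [le_div_iff₀ (by positivity)]; linarith)
    refine Real.log_nonneg ?_
    have : 0 ≤ 32 / (Δ ^ 2 * q) * Real.log (16 / (Δ ^ 2 * q)) := by positivity
    linarith
  have hK : (0 : ℝ) ≤ K := Nat.cast_nonneg K
  -- The value balances two constraints: `8 (1 + c)² ≤ 24` gives the leading constant, while `4c² -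
  -- 1 > 1` makes the upper tails summable, with sum at most 9.
  set c : ℝ := 8 / 11 with hc
  set C := 2 * (1 + c) * Real.sqrt (2 * L) with hC
  have hC0 : 0 ≤ C := by positivity
  have hC2 : C ^ 2 ≤ 24 * L := by
    rw [hC, mul_pow, Real.sq_sqrt (by positivity), hc]
    linarith
  set f : ℕ → ℝ := fun n => if n = 0 then 0 else max (C / Real.sqrt n - Δ) 0 with hf
  have hf0 : ∀ n, 0 ≤ f n := fun n => by
    simp only [hf]
    split_ifs
    · exact le_rfl
    · exact le_max_right _ _
  have hfB : ∀ N ≤ T, ∑ n ∈ Finset.range N, f n ≤ 24 * L / Δ := fun N _ => by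
    have h1 : ∑ n ∈ Finset.range N, f n ≤ C ^ 2 / Δ := by
      rcases Nat.eq_zero_or_pos N with rfl | hN
      · simp only [Finset.range_zero, Finset.sum_empty]; positivity
      · obtain ⟨m, rfl⟩ : ∃ m, N = m + 1 := ⟨N - 1, by omega⟩
        rw [Finset.sum_range_succ']
        simpa [hf] using sum_range_posPart_le hC0 hΔ m
    exact h1.trans (div_le_div_of_nonneg_right hC2 hΔ.le)
  have hreg := h.regret_le_two_add hB hf0 hfB (h.measurableSet_diverseFailure c q)
    (fun t ht => h.measureReal_diverseFailure_le hB (by rw [hc]; norm_num) hℓ.le (by omega))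
    (fun t ht _ ω hω => h.gap_le_of_notMem_diverseFailure hB (by rw [hc]; norm_num)
      (by rw [hc]; norm_num) hℓ (fun p hp a => minProb_le hB.simplex hp a) ht hω
      hLdef hC)
  have hs1 := sum_Ico_two_rpow_neg_le (s := 3) (by norm_num) T
  have hs2 := sum_Ico_two_rpow_neg_le (s := 4 * c ^ 2 - 1) (by rw [hc]; norm_num) T
  have hs3 := sum_Ico_two_exp_neg_mul_le (y := q ^ 2 / 2) (by positivity) T
  rw [← Finset.mul_sum, Finset.sum_add_distrib, Finset.sum_add_distrib] at hreg
  set m := min Δ (q ^ 2) with hm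
  have hm0 : 0 < m := lt_min hΔ (by positivity)
  have hmq : 1 / q ^ 2 ≤ 1 / m := one_div_le_one_div_of_le hm0 (min_le_right _ _)
  -- Since `q ≤ 1/2`, the additive constants 2 and `1/2 + 9` are absorbed into `3/m` and `5/m`.
  have hm4 : 4 ≤ 1 / m := by
    rw [le_div_iff₀ hm0]
    have : m ≤ q ^ 2 := min_le_right _ _
    nlinarith
  have hs2' : 1 / (4 * c ^ 2 - 1 - 1) ≤ 9 := by rw [hc]; norm_num
  have hs1' : (1 : ℝ) / (3 - 1) = 1 / 2 := by norm_num
  have hs3' : 1 / (q ^ 2 / 2) = 2 * (1 / q ^ 2) := by field_simp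
  have hbad := mul_le_mul_of_nonneg_left (add_le_add (add_le_add hs1 (hs2.trans hs2')) hs3) hK
  rw [hs1', hs3'] at hbad
  have e1 : 24 * K / Δ * L = K * (24 * L / Δ) := by ring
  have e2 : (7 * K + 3) / m = K * (7 * (1 / m)) + 3 * (1 / m) := by ring
  rw [e1, e2]
  have hbad2 : K * (1 / 2 + 9 + 2 * (1 / q ^ 2)) ≤ K * (7 * (1 / m)) :=
    mul_le_mul_of_nonneg_left (by linarith) hK
  linarith

end DiverseBound


/-! ### Bounded regret when every optimal mixed action is diverse. -/

section BoundedRegret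

variable {Ω : Type*} {mΩ : MeasurableSpace Ω} {K : ℕ} {P : Set (Fin K → ℝ)}
  {ν : Fin K → Measure ℝ} {Pr : Measure Ω} {ℱ : Filtration ℕ mΩ}
  {p : ℕ → Ω → Fin K → ℝ} {A : ℕ → Ω → Fin K} {Y : ℕ → Ω → ℝ}
  {E : Finset (Fin K → ℝ)} {e : Fin K → ℝ} {Δ : ℝ}

/-- The eighth root of `t`, the scale in which the lower bounds on the counts are expressed. -/
noncomputable def eighthRoot (t : ℕ) : ℝ := (t : ℝ) ^ (1 / 8 : ℝ)

lemma eighthRoot_nonneg (t : ℕ) : 0 ≤ eighthRoot t := by unfold eighthRoot; positivity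

lemma eighthRoot_pow (t : ℕ) : eighthRoot t ^ 8 = t := by
  rw [eighthRoot, ← Real.rpow_natCast, ← Real.rpow_mul (Nat.cast_nonneg t)]
  norm_num

lemma eventually_log_le_eighthRoot (M : ℝ) :
    ∀ᶠ t : ℕ in atTop, Real.log t ≤ eighthRoot t ∧ M ≤ eighthRoot t := by
  have h1 := (isLittleO_log_rpow_atTop (by norm_num : (0 : ℝ) < 1 / 8)).bound one_pos
  have h2 := (tendsto_rpow_atTop (by norm_num : (0 : ℝ) < 1 / 8)).eventually_ge_atTop M
  filter_upwards [tendsto_natCast_atTop_atTop.eventually h1,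
    tendsto_natCast_atTop_atTop.eventually h2] with t h3 h4
  refine ⟨?_, h4⟩
  rw [one_mul, Real.norm_of_nonneg (Real.log_natCast_nonneg t),
    Real.norm_of_nonneg (by positivity)] at h3
  exact h3

/-- A lower bound on the counts of the arms after `t` rounds, outside of `scarceFailure`. -/
noncomputable def countBound (K : ℕ) (Δ q : ℝ) (t : ℕ) : ℝ :=
  q * (3 * t / 4 - 1 - 8 * K * Real.log t / Δ ^ 2 * (eighthRoot t ^ 6 + 2 + Real.log t)) -
    eighthRoot t ^ 6

/-- With `y = t ^ (1/8)` and eventually `ln t ≤ y`, all corrections to `3qt/4` are of order `y ^ 7 =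
o(t)`, so the margin `qt/4` absorbs them. -/
lemma eventually_le_countBound (K : ℕ) {Δ q : ℝ} (hΔ : 0 < Δ) (hq : 0 < q) :
    ∀ᶠ t : ℕ in atTop, q * t / 2 ≤ countBound K Δ q t ∧ 16 * Real.log t < Δ ^ 2 * (q * t) := by
  -- `M` adds up the coefficients of `y ^ 7`; the 32 is `8 * 4`, from `y ^ 6 + 2 + ln t ≤ 4 y ^ 6`.
  set M := q + 32 * K * q / Δ ^ 2 + 1 with hM
  have hK : (0 : ℝ) ≤ K := Nat.cast_nonneg K
  filter_upwards [eventually_log_le_eighthRoot (max 1 (max (4 * M / q) (17 / (Δ ^ 2 * q))))]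
    with t ⟨hlog, hy⟩
  have hl0 := Real.log_natCast_nonneg t
  have hy1 : 1 ≤ eighthRoot t := (le_max_left _ _).trans hy
  have hyM : 4 * M / q ≤ eighthRoot t := ((le_max_left _ _).trans (le_max_right _ _)).trans hy
  have hyΔ : 17 / (Δ ^ 2 * q) ≤ eighthRoot t :=
    ((le_max_right _ _).trans (le_max_right _ _)).trans hy
  rw [countBound, ← eighthRoot_pow t, Real.log_pow]
  rw [← eighthRoot_pow t, Real.log_pow] at hlog hl0
  set l := ((8 : ℕ) : ℝ) * Real.log (eighthRoot t)
  set y := eighthRoot t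
  have hy6 : 1 ≤ y ^ 6 := one_le_pow₀ hy1
  have hy67 : y ^ 6 ≤ y ^ 7 := pow_le_pow_right₀ hy1 (by norm_num)
  have hyy6 : y ≤ y ^ 6 := le_self_pow₀ hy1 (by norm_num)
  have h8 : y ^ 8 = y * y ^ 7 := by ring
  constructor
  · have h1 : l * (y ^ 6 + 2 + l) ≤ 4 * y ^ 7 := by
      calc l * (y ^ 6 + 2 + l) ≤ y * (4 * y ^ 6) :=
            mul_le_mul hlog (by linarith) (by positivity) (by linarith)
        _ = 4 * y ^ 7 := by ring
    have h2 : q * (8 * K * l / Δ ^ 2 * (y ^ 6 + 2 + l)) ≤ 32 * K * q / Δ ^ 2 * y ^ 7 := by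
      have := mul_le_mul_of_nonneg_left h1 (by positivity : 0 ≤ 8 * K * q / Δ ^ 2)
      calc _ = 8 * K * q / Δ ^ 2 * (l * (y ^ 6 + 2 + l)) := by ring
        _ ≤ _ := this
        _ = _ := by ring
    have h3 : M * y ^ 7 ≤ q * y ^ 8 / 4 := by
      rw [div_le_iff₀ hq] at hyM
      have := mul_le_mul_of_nonneg_right hyM (by positivity : 0 ≤ y ^ 7)
      rw [h8]
      linarith
    have h4 : M * y ^ 7 = q * y ^ 7 + 32 * K * q / Δ ^ 2 * y ^ 7 + y ^ 7 := by rw [hM]; ring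
    have h5 : q ≤ q * y ^ 7 := le_mul_of_one_le_right hq.le (hy6.trans hy67)
    linarith
  · have hpos : 0 < y ^ 7 := by positivity
    rw [div_le_iff₀ (by positivity)] at hyΔ
    have := mul_le_mul_of_nonneg_right hyΔ hpos.le
    have e : Δ ^ 2 * (q * y ^ 8) = y * (Δ ^ 2 * q) * y ^ 7 := by ring
    rw [e]
    have : l ≤ y ^ 7 := hlog.trans (hyy6.trans hy67)
    linarith

/-- The weights used to compare the realized inverse counts with their predictions. -/
noncomputable def invCount (A : ℕ → Ω → Fin K) (a : Fin K) (s : ℕ) (ω : Ω) : ℝ :=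
  1 / (max (pulls A a s ω) 1 : ℕ)

lemma invCount_mem_Icc (a : Fin K) (s : ℕ) (ω : Ω) :
    invCount A a s ω ∈ Set.Icc (0 : ℝ) 1 := by
  refine ⟨by unfold invCount; positivity, ?_⟩
  rw [invCount, div_le_one (by positivity)]
  exact_mod_cast le_max_right _ _

lemma IsProtocol.measurable_invCount (h : IsProtocol P ν Pr ℱ p A Y) (a : Fin K) (s : ℕ) :
    Measurable[ℱ s] (invCount A a s) :=
  h.measurable_comp_pulls (fun n => 1 / (max n 1 : ℕ)) a s

/-- The realized sum of inverse counts is harmonic, and `drift` is what separates it from the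
predicted one. -/
lemma sum_invCount_mul_le (a : Fin K) (t : ℕ) (ω : Ω) :
    ∑ s ∈ Finset.range t, invCount A a s ω * p (s + 1) ω a ≤
      drift p A a (invCount A a) t ω + (2 + Real.log t) := by
  have h1 := sum_ite_mul_pulls (A := A) a (fun n => 1 / (max n 1 : ℕ)) t ω
  have h2 := sum_range_inv_max_one_le (pulls_le (A := A) a t ω)
  have h3 : drift p A a (invCount A a) t ω =
      ∑ s ∈ Finset.range t, invCount A a s ω * p (s + 1) ω a -
        ∑ s ∈ Finset.range t, invCount A a s ω * (if A (s + 1) ω = a then 1 else 0) := by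
    simp only [drift, mul_sub, Finset.sum_sub_distrib]
  simp only [invCount] at h3 ⊢
  linarith

/-- The event that some average reward is far from its mean after `s` rounds, for some `s` between
`t / 4` and `t`, or that some count or weighted count deviates from its prediction. -/
def scarceFailure (ν : Fin K → Measure ℝ) (p : ℕ → Ω → Fin K → ℝ) (A : ℕ → Ω → Fin K)
    (Y : ℕ → Ω → ℝ) (t : ℕ) : Set Ω :=
  (⋃ s ∈ (Finset.range (t + 1)).filter (fun s => t ≤ 4 * s), failure ν A Y 1 s) ∪
    ((⋃ a, {ω | eighthRoot t ^ 6 ≤ drift p A a (fun _ _ => 1) t ω}) ∪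
      ⋃ a, {ω | eighthRoot t ^ 6 ≤ drift p A a (invCount A a) t ω})

lemma IsProtocol.measurableSet_scarceFailure (h : IsProtocol P ν Pr ℱ p A Y) (t : ℕ) :
    MeasurableSet (scarceFailure ν p A Y t) := by
  refine (Finset.measurableSet_biUnion _ fun s _ => h.measurableSet_failure 1 s).union
    ((MeasurableSet.iUnion fun a => measurableSet_le measurable_const ?_).union
      (MeasurableSet.iUnion fun a => measurableSet_le measurable_const ?_))
  · exact (h.measurable_drift a (fun _ => measurable_const) t).mono (ℱ.le t) le_rfl
  · exact (h.measurable_drift a (h.measurable_invCount a) t).mono (ℱ.le t) le_rfl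

lemma IsProtocol.measureReal_scarceFailure_le (h : IsProtocol P ν Pr ℱ p A Y)
    [IsProbabilityMeasure Pr] (hB : IsBanditModel P E ν e Δ) {t : ℕ} (ht : 1 ≤ t) :
    Pr.real (scarceFailure ν p A Y t) ≤ 300 * K * (t : ℝ) ^ (-2 : ℝ) := by
  have ht1 : (1 : ℝ) ≤ t := by exact_mod_cast ht
  have ht0 : (0 : ℝ) < t := by linarith
  have hK : (0 : ℝ) ≤ K := Nat.cast_nonneg K
  have hsq : (t : ℝ) ^ (-2 : ℝ) = 1 / (t : ℝ) ^ 2 := by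
    rw [Real.rpow_neg ht0.le, one_div]; norm_num
  have hexp : Real.exp (-(2 * (eighthRoot t ^ 6) ^ 2 / t)) ≤ 2 * (1 / (t : ℝ) ^ 2) := by
    have hy : 0 < eighthRoot t := by unfold eighthRoot; positivity
    have e1 : 2 * (eighthRoot t ^ 6) ^ 2 / t = 2 * eighthRoot t ^ 4 := by
      rw [← eighthRoot_pow t]; field_simp
    -- The deviation `t ^ (3/4)` gives the Azuma exponent `2 √t = 2 y ^ 4`; the fourth term of the
    -- exponential series already yields the order `t⁻²`.
    have h1 := Real.pow_div_factorial_le_exp (2 * eighthRoot t ^ 4) (by positivity) 4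
    have e2 : (2 * eighthRoot t ^ 4) ^ 4 / (Nat.factorial 4 : ℕ) = 2 / 3 * (t : ℝ) ^ 2 := by
      rw [← eighthRoot_pow t]
      norm_num [Nat.factorial]
      ring
    rw [e2] at h1
    rw [e1, Real.exp_neg, ← one_div, mul_one_div, div_le_div_iff₀ (Real.exp_pos _) (by positivity)]
    have : 0 < (t : ℝ) ^ 2 := by positivity
    linarith
  have hdrift : ∀ a, Pr.real {ω | eighthRoot t ^ 6 ≤ drift p A a (fun _ _ => 1) t ω} ≤
      2 * (1 / (t : ℝ) ^ 2) := fun a =>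
    (h.measureReal_drift_ge_le hB.simplex hB.prob a (fun _ => measurable_const)
      (fun _ _ => by simp) ht (pow_nonneg (eighthRoot_nonneg t) 6)).trans hexp
  have hdrift' : ∀ a, Pr.real {ω | eighthRoot t ^ 6 ≤ drift p A a (invCount A a) t ω} ≤
      2 * (1 / (t : ℝ) ^ 2) := fun a =>
    (h.measureReal_drift_ge_le hB.simplex hB.prob a (h.measurable_invCount a)
      (fun s ω => invCount_mem_Icc a s ω) ht (pow_nonneg (eighthRoot_nonneg t) 6)).trans hexp
  have hfail : Pr.real (⋃ s ∈ (Finset.range (t + 1)).filter (fun s => t ≤ 4 * s),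
      failure ν A Y 1 s) ≤ 256 * K * (1 / (t : ℝ) ^ 2) := by
    have hterm : ∀ s ∈ (Finset.range (t + 1)).filter (fun s => t ≤ 4 * s),
        Pr.real (failure ν A Y 1 s) ≤ 128 * K / (t : ℝ) ^ 3 := by
      intro s hs
      have hts : t ≤ 4 * s := (Finset.mem_filter.1 hs).2
      have hts' : (t : ℝ) ≤ 4 * s := by exact_mod_cast hts
      have hs0 : (0 : ℝ) < s := by linarith
      -- As `s ≥ t / 4`, each `s⁻³` is at most `64 t⁻³`, and two tails per arm give `128 K`; summing
      -- over at most `2t` times `s` leaves order `t⁻²`.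
      refine (h.measureReal_failure_le hB zero_le_one (t := s) (by omega)).trans ?_
      have e1 : (s : ℝ) ^ (-3 : ℝ) = 1 / (s : ℝ) ^ 3 := by
        rw [Real.rpow_neg hs0.le, one_div]; norm_num
      have e2 : (-(4 * 1 ^ 2 - 1) : ℝ) = -3 := by norm_num
      rw [e2, e1, le_div_iff₀ (by positivity)]
      have h3 := pow_le_pow_left₀ ht0.le hts' 3
      have h4 : 1 / (s : ℝ) ^ 3 * (t : ℝ) ^ 3 ≤ 64 := by
        rw [div_mul_eq_mul_div, div_le_iff₀ (by positivity)]
        linarith [mul_pow (4 : ℝ) s 3]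
      have := mul_le_mul_of_nonneg_left h4 hK
      linarith
    calc _ ≤ ∑ s ∈ (Finset.range (t + 1)).filter (fun s => t ≤ 4 * s),
          Pr.real (failure ν A Y 1 s) := measureReal_biUnion_finset_le _ _
      _ ≤ ((Finset.range (t + 1)).filter (fun s => t ≤ 4 * s)).card • (128 * K / (t : ℝ) ^ 3) :=
          Finset.sum_le_card_nsmul _ _ _ hterm
      _ ≤ (2 * t) * (128 * K / (t : ℝ) ^ 3) := by
          rw [nsmul_eq_mul]
          refine mul_le_mul_of_nonneg_right ?_ (by positivity)
          have hc : ((Finset.range (t + 1)).filter (fun s => t ≤ 4 * s)).card ≤ 2 * t :=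
            (Finset.card_filter_le _ _).trans (by rw [Finset.card_range]; omega)
          exact_mod_cast hc
      _ = 256 * K * (1 / (t : ℝ) ^ 2) := by field_simp; ring
  have hall := (measureReal_union_le (μ := Pr) _ _).trans (add_le_add hfail
    ((measureReal_union_le (μ := Pr) _ _).trans (add_le_add
      (measureReal_iUnion_fin_le hdrift) (measureReal_iUnion_fin_le hdrift'))))
  rw [hsq]
  refine hall.trans ?_
  have : 0 ≤ K * (1 / (t : ℝ) ^ 2) := by positivity
  linarith

lemma card_filter_four_mul_lt_le (t : ℕ) :
    (((Finset.range t).filter (fun s => 4 * s < t)).card : ℝ) ≤ t / 4 + 1 := by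
  have hsub : (Finset.range t).filter (fun s => 4 * s < t) ⊆ Finset.range (t / 4 + 1) := by
    intro s hs
    have := (Finset.mem_filter.1 hs).2
    exact Finset.mem_range.2 (by omega)
  have h1 := Finset.card_le_card hsub
  rw [Finset.card_range] at h1
  calc (((Finset.range t).filter (fun s => 4 * s < t)).card : ℝ) ≤ ((t / 4 + 1 : ℕ) : ℝ) := by
        exact_mod_cast h1
    _ ≤ t / 4 + 1 := by push_cast; linarith [Nat.cast_div_le (α := ℝ) (m := t) (n := 4)]

/-- When the optimal actions put mass at least `q` on all arms, then all arms are drawn often. -/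
lemma IsDivUCB.countBound_le_pulls (h : IsDivUCB P E ν Pr ℱ p A Y)
    (hB : IsBanditModel P E ν e Δ) {q : ℝ} (hq0 : 0 < q)
    (hq : ∀ p ∈ optActions P (means ν), ∀ a, q ≤ p a) {t : ℕ} (ht : 8 ≤ t) {ω : Ω}
    (hω : ω ∉ scarceFailure ν p A Y t) (a : Fin K) :
    countBound K Δ q t ≤ pulls A a t ω := by
  have hΔ := hB.gap_pos
  have hlog := Real.log_natCast_nonneg t
  simp only [scarceFailure, Set.mem_union, Set.mem_iUnion, not_or, not_exists] at hω
  obtain ⟨hfail, hdrift, hdrift'⟩ := hω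
  set G : ℕ → ℝ := fun s => gap P (means ν) (p (s + 1) ω) with hG
  have hG0 : ∀ s, 0 ≤ G s := fun s => hB.gap_nonneg (h.mem s ω)
  have hp0 : ∀ s b, 0 ≤ p (s + 1) ω b := fun s b => (hB.simplex (h.mem s ω)).1 b
  -- An optimal action has `p_a ≥ q`. For a suboptimal one the left side is nonpositive, since `G s
  -- / Δ ≥ 1` or `s` is among the discarded early rounds. Summing bounds the predicted count below
  -- by `q` times the number of late rounds less the total gap over `Δ`.
  have hterm : ∀ s ∈ Finset.range t, q * (1 - (if 4 * s < t then 1 else 0) -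
      (if 4 * s < t then 0 else G s) / Δ) ≤ p (s + 1) ω a := by
    intro s _
    rcases (hG0 s).eq_or_lt with h0 | h0
    · refine le_trans ?_ (hq _ (hB.mem_optActions (h.mem s ω) (le_of_eq h0.symm)) a)
      refine mul_le_of_le_one_right hq0.le ?_
      split_ifs
      · simp
      · rw [← h0]; simp
    · refine le_trans (mul_nonpos_of_nonneg_of_nonpos hq0.le ?_) (hp0 s a)
      split_ifs
      · simp
      · have := (one_le_div hΔ).2 (hB.gap_le _ (h.argmax_mem s ω) h0)
        simp only [sub_zero]
        linarith
  have hGsum : ∑ s ∈ Finset.range t, (if 4 * s < t then 0 else G s) ≤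
      8 * Real.log t / Δ * (K * (eighthRoot t ^ 6 + 2 + Real.log t)) := by
    calc ∑ s ∈ Finset.range t, (if 4 * s < t then 0 else G s)
        ≤ ∑ s ∈ Finset.range t, ∑ b, 8 * Real.log t / Δ *
            (invCount A b s ω * p (s + 1) ω b) := by
          refine Finset.sum_le_sum fun s hs => ?_
          have hst := Finset.mem_range.1 hs
          split_ifs with h4
          · exact Finset.sum_nonneg fun b _ => mul_nonneg (by positivity)
              (mul_nonneg (invCount_mem_Icc b s ω).1 (hp0 s b))
          -- From `t ≥ 8` and `s ≥ t / 4` comes `s ≥ 2`, as the pathwise gap bound requires.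
          · have := h.gap_le_log_div hB (t := s) (by omega) (T := t) (by exact_mod_cast hst.le)
              (hfail s (Finset.mem_filter.2 ⟨Finset.mem_range.2 (by omega), by omega⟩))
            simpa only [invCount, mul_assoc] using this
      _ = 8 * Real.log t / Δ * ∑ b, ∑ s ∈ Finset.range t, invCount A b s ω * p (s + 1) ω b := by
          rw [Finset.sum_comm, Finset.mul_sum]
          exact Finset.sum_congr rfl fun b _ => (Finset.mul_sum _ _ _).symm
      _ ≤ 8 * Real.log t / Δ * ∑ _b : Fin K, (eighthRoot t ^ 6 + 2 + Real.log t) := by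
          refine mul_le_mul_of_nonneg_left (Finset.sum_le_sum fun b _ => ?_) (by positivity)
          have h1 : drift p A b (invCount A b) t ω < eighthRoot t ^ 6 := not_le.1 (hdrift' b)
          linarith [sum_invCount_mul_le (p := p) (A := A) b t ω]
      _ = _ := by rw [Finset.sum_const, Finset.card_univ, Fintype.card_fin, nsmul_eq_mul]
  have hsum := Finset.sum_le_sum hterm
  rw [← Finset.mul_sum, Finset.sum_sub_distrib, Finset.sum_sub_distrib, ← Finset.sum_div,
    Finset.sum_boole] at hsum
  simp only [Finset.sum_const, Finset.card_range, nsmul_eq_mul, mul_one] at hsum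
  have hcard := card_filter_four_mul_lt_le t
  have h1 : drift p A a (fun _ _ => 1) t ω < eighthRoot t ^ 6 := not_le.1 (hdrift a)
  rw [drift_one] at h1
  have h2 : (∑ s ∈ Finset.range t, (if 4 * s < t then 0 else G s)) / Δ ≤
      8 * K * Real.log t / Δ ^ 2 * (eighthRoot t ^ 6 + 2 + Real.log t) := by
    rw [div_le_iff₀ hΔ]
    refine hGsum.trans (le_of_eq ?_)
    field_simp
  have h3 : q * (3 * t / 4 - 1 -
      8 * K * Real.log t / Δ ^ 2 * (eighthRoot t ^ 6 + 2 + Real.log t)) ≤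
      ∑ s ∈ Finset.range t, p (s + 1) ω a :=
    (mul_le_mul_of_nonneg_left (by linarith) hq0.le).trans hsum
  rw [countBound]
  linarith

/-- A positive gap would be at least `Δ`, yet counts of at least `qt/2` keep twice the bonuses below
`Δ` for such `t`. -/
lemma IsDivUCB.gap_nonpos_of_notMem_scarceFailure (h : IsDivUCB P E ν Pr ℱ p A Y)
    (hB : IsBanditModel P E ν e Δ) {q : ℝ} (hq0 : 0 < q)
    (hq : ∀ p ∈ optActions P (means ν), ∀ a, q ≤ p a) {t : ℕ} (ht : 8 ≤ t)
    (hcount : q * t / 2 ≤ countBound K Δ q t) (hlog : 16 * Real.log t < Δ ^ 2 * (q * t))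
    {ω : Ω} (hω : ω ∉ scarceFailure ν p A Y t) :
    gap P (means ν) (p (t + 1) ω) ≤ 0 := by
  by_contra! hpos
  have hs := hB.simplex (h.mem t ω)
  have ht0 : (0 : ℝ) < t := by exact_mod_cast (by omega : 0 < t)
  have hlog0 := Real.log_natCast_nonneg t
  have hfail : ω ∉ failure ν A Y 1 t := fun hmem => hω (Or.inl (Set.mem_biUnion
    (Finset.mem_coe.2 (Finset.mem_filter.2 ⟨Finset.mem_range.2 (by omega), by omega⟩)) hmem))
  have hb : ∀ a, bonus t (pulls A a t ω) ≤ Real.sqrt (4 * Real.log t / (q * t)) := fun a => by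
    have hpull := hcount.trans (h.countBound_le_pulls hB hq0 hq ht hω a)
    rw [bonus]
    refine Real.sqrt_le_sqrt ?_
    rw [show 4 * Real.log t / (q * t) = 2 * Real.log t / (q * t / 2) by field_simp; ring]
    refine div_le_div_of_nonneg_left (by positivity) (by positivity) (hpull.trans ?_)
    exact_mod_cast le_max_left _ _
  have h1 : Δ ≤ 2 * Real.sqrt (4 * Real.log t / (q * t)) := by
    refine ((hB.gap_le _ (h.argmax_mem t ω) hpos).trans
      (h.gap_le_two_mul_bonus hB (by omega) hfail)).trans ?_
    calc _ ≤ ∑ a, 2 * Real.sqrt (4 * Real.log t / (q * t)) * p (t + 1) ω a :=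
          Finset.sum_le_sum fun a _ => mul_le_mul_of_nonneg_right
            (mul_le_mul_of_nonneg_left (hb a) two_pos.le) (hs.1 a)
      _ = _ := by rw [← Finset.mul_sum, hs.2, mul_one]
  have h2 := pow_le_pow_left₀ hB.gap_pos.le h1 2
  rw [mul_pow, Real.sq_sqrt (by positivity), ← mul_div_assoc, le_div_iff₀ (by positivity)] at h2
  linarith

/-- The bound on the regret when all optimal mixed actions put some mass on all arms. -/
theorem exists_forall_regret_le (hB : IsBanditModel P E ν e Δ)
    (hq : 0 < minProb (optActions P (means ν))) :
    ∃ C : ℝ, ∀ (Ω : Type u) (mΩ : MeasurableSpace Ω) (Pr : Measure Ω)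
      (_ : IsProbabilityMeasure Pr) (ℱ : Filtration ℕ mΩ)
      (p : ℕ → Ω → Fin K → ℝ) (A : ℕ → Ω → Fin K) (Y : ℕ → Ω → ℝ),
      IsDivUCB P E ν Pr ℱ p A Y → ∀ T, regret P ν Pr p T ≤ C := by
  obtain ⟨t₀, ht₀⟩ := eventually_atTop.1
    ((eventually_le_countBound K hB.gap_pos hq).and (eventually_ge_atTop 8))
  have hqle : ∀ p ∈ optActions P (means ν), ∀ a, minProb (optActions P (means ν)) ≤ p a :=
    fun p hp a => minProb_le (fun p hp => hB.simplex hp.1) hp a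
  -- `t₀` depends only on `K`, `Δ` and the least optimal probability, so the constant is uniform
  -- over probability spaces and tie-breaking rules. Times before `t₀` are simply declared bad, and
  -- afterwards the gap vanishes off the bad event, hence `f = 0`.
  refine ⟨2 + (t₀ + 300 * K), fun Ω mΩ Pr _ ℱ p A Y h T => ?_⟩
  set bad : ℕ → Set Ω := fun t => if t < t₀ then Set.univ else scarceFailure ν p A Y t with hbad
  have hreg := h.regret_le_two_add hB (f := fun _ => 0) (fun _ => le_rfl) (T := T) (B := 0)
    (fun _ _ => by simp) (bad := bad) (fun t => ?_)
    (v := fun t => (if t < t₀ then 1 else 0) + 300 * K * (t : ℝ) ^ (-2 : ℝ)) (fun t ht => ?_)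
    (fun t _ _ ω hω => ?_)
  · rw [Finset.sum_add_distrib, ← Finset.mul_sum, Finset.sum_boole] at hreg
    have h1 : (((Finset.Ico 2 T).filter (fun t => t < t₀)).card : ℝ) ≤ t₀ := by
      have : (Finset.Ico 2 T).filter (fun t => t < t₀) ⊆ Finset.range t₀ := fun t ht =>
        Finset.mem_range.2 (Finset.mem_filter.1 ht).2
      have := Finset.card_le_card this
      rw [Finset.card_range] at this
      exact_mod_cast this
    have h2 := mul_le_mul_of_nonneg_left (sum_Ico_two_rpow_neg_le (s := 2) (by norm_num) T)
      (by positivity : (0 : ℝ) ≤ 300 * K)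
    rw [show (2 : ℝ) - 1 = 1 by norm_num, div_one, mul_one] at h2
    rw [mul_zero, add_zero] at hreg
    linarith
  · by_cases ht : t < t₀
    · simp only [hbad, ht, if_true, MeasurableSet.univ]
    · simpa only [hbad, ht, if_false] using h.measurableSet_scarceFailure t
  · by_cases ht' : t < t₀
    · simp only [ht', if_true]
      have : 0 ≤ 300 * K * (t : ℝ) ^ (-2 : ℝ) := by positivity
      linarith [measureReal_le_one (μ := Pr) (s := bad t)]
    · simp only [hbad, ht', if_false, zero_add]
      exact h.measureReal_scarceFailure_le hB (by omega)
  · by_cases ht : t < t₀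
    · simp only [hbad, ht, if_true, Set.mem_univ, not_true] at hω
    · simp only [hbad, ht, if_false] at hω
      obtain ⟨⟨h1, h2⟩, h3⟩ := ht₀ t (not_lt.1 ht)
      simpa using h.gap_nonpos_of_notMem_scarceFailure hB hq hqle h3 h1 h2 hω

/-- The increments of the regret are expected gaps, hence nonnegative, so a bounded regret converges
to its supremum. -/
lemma IsProtocol.exists_tendsto_regret (h : IsProtocol P ν Pr ℱ p A Y)
    [IsProbabilityMeasure Pr] (hB : IsBanditModel P E ν e Δ) {C : ℝ}
    (hC : ∀ T, regret P ν Pr p T ≤ C) :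
    ∃ R ≤ C, Tendsto (fun T : ℕ => regret P ν Pr p T) atTop (𝓝 R) := by
  have hmono : Monotone fun T : ℕ => regret P ν Pr p T := monotone_nat_of_le_succ fun T => by
    rw [h.regret_succ hB]
    exact le_add_of_nonneg_right (integral_nonneg fun ω => hB.gap_nonneg (h.mem T ω))
  exact ⟨⨆ T, regret P ν Pr p T, ciSup_le hC,
    tendsto_atTop_ciSup hmono ⟨C, by rintro _ ⟨T, rfl⟩; exact hC T⟩⟩

end BoundedRegret

end DivBandit

theorem theorem1 {K : ℕ} (P : Set (Fin K → ℝ)) (E : Finset (Fin K → ℝ))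
    (hP : P ⊆ stdSimplex ℝ (Fin K))
    (hE : P = convexHull ℝ (E : Set (Fin K → ℝ)))
    (ν : Fin K → Measure ℝ) (hprob : ∀ a, IsProbabilityMeasure (ν a))
    (hν : ∀ a, ν a (Set.Icc 0 1) = 1)
    (hsub : ∃ p ∈ E, 0 < DivBandit.gap P (DivBandit.means ν) p) :
    -- first bound, in all cases
    (∀ (Ω : Type u) (mΩ : MeasurableSpace Ω) (Pr : Measure Ω) (_ : IsProbabilityMeasure Pr)
        (ℱ : Filtration ℕ mΩ) (p : ℕ → Ω → Fin K → ℝ) (A : ℕ → Ω → Fin K) (Y : ℕ → Ω → ℝ),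
        DivBandit.IsDivUCB P E ν Pr ℱ p A Y → ∀ T : ℕ,
          DivBandit.regret P ν Pr p T ≤
            (24 * K * (Real.log (1 + T)) ^ 2 + K + 2) /
              DivBandit.minGap P E (DivBandit.means ν)) ∧
    -- bounded regret, when all optimal mixed actions put mass on all arms
    (0 < DivBandit.minProb (DivBandit.optActions P (DivBandit.means ν)) →
      ∃ C : ℝ, ∀ (Ω : Type u) (mΩ : MeasurableSpace Ω) (Pr : Measure Ω)
        (_ : IsProbabilityMeasure Pr) (ℱ : Filtration ℕ mΩ)
        (p : ℕ → Ω → Fin K → ℝ) (A : ℕ → Ω → Fin K) (Y : ℕ → Ω → ℝ),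
        DivBandit.IsDivUCB P E ν Pr ℱ p A Y →
          ∃ R ≤ C, Tendsto (fun T : ℕ => DivBandit.regret P ν Pr p T) atTop (𝓝 R)) ∧
    -- closed-form bound, when all mixed actions put mass on all arms
    (0 < DivBandit.minProb P →
      ∀ (Ω : Type u) (mΩ : MeasurableSpace Ω) (Pr : Measure Ω) (_ : IsProbabilityMeasure Pr)
        (ℱ : Filtration ℕ mΩ) (p : ℕ → Ω → Fin K → ℝ) (A : ℕ → Ω → Fin K) (Y : ℕ → Ω → ℝ),
        DivBandit.IsDivUCB P E ν Pr ℱ p A Y → ∀ T : ℕ,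
          DivBandit.regret P ν Pr p T ≤
            24 * K / DivBandit.minGap P E (DivBandit.means ν) *
              Real.log (1 + 32 / ((DivBandit.minGap P E (DivBandit.means ν)) ^ 2
                  * DivBandit.minProb P) *
                Real.log (16 / ((DivBandit.minGap P E (DivBandit.means ν)) ^ 2
                  * DivBandit.minProb P))) +
            (7 * K + 3) / min (DivBandit.minGap P E (DivBandit.means ν))
              ((DivBandit.minProb P) ^ 2)) := by
  obtain ⟨e, hB⟩ := DivBandit.exists_isBanditModel hP hE hprob hν hsub
  refine ⟨fun Ω mΩ Pr _ ℱ p A Y h T => h.regret_le_log_sq hB T, fun hq => ?_,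
    fun hℓ Ω mΩ Pr _ ℱ p A Y h T => h.regret_le_of_minProb_pos hB hsub hℓ T⟩
  obtain ⟨C, hC⟩ := DivBandit.exists_forall_regret_le hB hq
  exact ⟨C, fun Ω mΩ Pr hPr ℱ p A Y h => h.exists_tendsto_regret hB (hC Ω mΩ Pr hPr ℱ p A Y h)⟩
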